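/- **Model.** Let $m,A,T_s,g,l,\sigma_B,\sigma_E,P>0$, $0<\xi\le 1$, $0\le\rho<D$ and $\eta_B,\eta_E\in\mathbb R$. A transmitter is at height $l$ above the centre $O$ of a disc $\mathcal S$ of radius $D$ (the receiver zone); $\mathcal P$ is the concentric disc of radius $\rho$ (the protected zone). Bob's position $U$ is uniformly distributed in $\mathcal S$, Eve's position $W$ is uniformly distributed in $\mathcal S\setminus\mathcal P$, and $U,W$ are independent. A receiver at distance $d$ from the transmitter has the channel gain $$H=\frac{(m+1)A}{2\pi d^2}\,T_s\,g\,\cos^m(\phi)\cos(\psi),\qquad \cos\phi=\cos\psi=l/d ;$$ $H_B,H_E$ denote the gains of Bob and Eve. Put $$\chi=10^{\frac{\eta_B-\eta_E}{10}}\frac{\sqrt e\,\sigma_E}{\sqrt{2\pi}\,\sigma_B},\qquad C_s^+=\frac12\ln\!\left(\frac{\sigma_E^2}{2\pi\sigma_B^2}\cdot\frac{e\,\xi^2P^2 10^{\eta_B/5}H_B^2+2\pi\sigma_B^2}{10^{\eta_E/5}H_E^2\xi^2P^2+\sigma_E^2}\right),$$ and let $C_s=C_s^+$ if $\chi H_B\ge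 H_E$ and $C_s=0$ otherwise (the lower bound on the instantaneous secrecy capacity under imperfect CSIR, which replaces the secrecy capacity throughout). The average secrecy capacity is $\overline{C_s}=\mathbb E[C_s]$. **Constants.** Let $K=\frac{(m+1)AT_sg\,l^{m+1}}{2\pi}$, $v_{\min}=K(D^2+l^2)^{-\frac{m+3}2}$, $v_{\rm mid}=K(\rho^2+l^2)^{-\frac{m+3}2}$, $v_{\max}=K\,l^{-(m+3)}$, $\Xi_1=\frac{2}{(m+3)D^2}K^{\frac2{m+3}}$, $\Xi_2=\frac{2}{(m+3)(D^2-\rho^2)}K^{\frac2{m+3}}$, $d_B=\frac{e\,10^{\eta_B/5}}{2\pi\sigma_B^2}$, $d_E=\frac{10^{\eta_E/5}}{\sigma_E^2}$, $q=\frac{m+3}{2}$, and $$\lambda(a,b,c,d)=a\left(b^{-\frac1a}-c^{-\frac1a}\right)\ln(2\pi\sigma_B^2\sigma_E^2)+\tfrac12c^{-\frac1a}\,\mathcal G_a(d\xi^2P^2c^2)-\tfrac12b^{-\frac1a}\,\mathcal G_a(d\xi^2P^2b^2),$$ where $\mathcal G_a(z)=G^{1,3}_{3,3}\!\left[z\,\middle|\,{1,\,1,\,1+\frac1{2a}\atop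 1,\,\frac1{2a},\,0}\right]$ is a Meijer $G$-function. **Theorem.** $C_s$ is integrable, $$\overline{C_s}=\int_{v_{\min}}^{v_{\rm mid}}\!\int_{v_{\min}}^{v_{\max}}C_s(x,y)\,f_{H_B}(x)f_{H_E}(y)\,dx\,dy,$$ where $C_s(x,y)$ is $C_s$ at $H_B=x$, $H_E=y$, $f_{H_B}(x)=\Xi_1x^{-\frac2{m+3}-1}$ on $[v_{\min},v_{\max}]$ and $f_{H_E}(y)=\Xi_2y^{-\frac2{m+3}-1}$ on $[v_{\min},v_{\rm mid}]$, and $$\overline{C_s}=\begin{cases}0,&\chi\le v_{\min}/v_{\max},\\ C_1,&v_{\min}/v_{\max}<\chi\le v_{\rm mid}/v_{\max},\\ C_2,&v_{\rm mid}/v_{\max}<\chi\le1,\\ C_3,&1<\chi\le v_{\rm mid}/v_{\min},\\ C_4,&\chi>v_{\rm mid}/v_{\min},\end{cases}$$ where $$C_1=\tfrac{(m+3)\Xi_1\Xi_2}{4}\Big[v_{\min}^{-\frac1q}\lambda\big(q,\tfrac{v_{\min}}\chi,v_{\max},d_B\big)-\chi^{-\frac1q}\lambda\big(\tfrac q2,\tfrac{v_{\min}}\chi,v_{\max},d_B\big)-\chi^{\frac1q}\lambda\big(\tfrac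 q2,v_{\min},\chi v_{\max},d_E\big)+v_{\max}^{-\frac1q}\lambda\big(q,v_{\min},\chi v_{\max},d_E\big)\Big],$$ $$\begin{aligned}C_2=\tfrac{(m+3)\Xi_1\Xi_2}{4}\Big[&v_{\min}^{-\frac1q}\lambda\big(q,\tfrac{v_{\min}}\chi,\tfrac{v_{\rm mid}}\chi,d_B\big)-\chi^{-\frac1q}\lambda\big(\tfrac q2,\tfrac{v_{\min}}\chi,\tfrac{v_{\rm mid}}\chi,d_B\big)+\big(v_{\min}^{-\frac1q}-v_{\rm mid}^{-\frac1q}\big)\lambda\big(q,\tfrac{v_{\rm mid}}\chi,v_{\max},d_B\big)\\&-\chi^{\frac1q}\lambda\big(\tfrac q2,v_{\min},v_{\rm mid},d_E\big)+v_{\max}^{-\frac1q}\lambda\big(q,v_{\min},v_{\rm mid},d_E\big)\Big],\end{aligned}$$ $$\begin{aligned}C_3=\tfrac{(m+3)\Xi_1\Xi_2}{4}\Big\{&v_{\min}^{-\frac1q}\lambda\big(q,v_{\min},\tfrac{v_{\rm mid}}\chi,d_B\big)-\chi^{-\frac1q}\lambda\big(\tfrac q2,v_{\min},\tfrac{v_{\rm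 mid}}\chi,d_B\big)-\Big[v_{\min}^{-\frac1q}-\big(\tfrac{v_{\rm mid}}\chi\big)^{-\frac1q}\Big]\lambda\big(q,v_{\min},\chi v_{\min},d_E\big)\\&-\chi^{\frac1q}\lambda\big(\tfrac q2,\chi v_{\min},v_{\rm mid},d_E\big)+\big(\tfrac{v_{\rm mid}}\chi\big)^{-\frac1q}\lambda\big(q,\chi v_{\min},v_{\rm mid},d_E\big)\\&+\big(v_{\min}^{-\frac1q}-v_{\rm mid}^{-\frac1q}\big)\lambda\big(q,\tfrac{v_{\rm mid}}\chi,v_{\max},d_B\big)-\Big[\big(\tfrac{v_{\rm mid}}\chi\big)^{-\frac1q}-v_{\max}^{-\frac1q}\Big]\lambda\big(q,v_{\min},v_{\rm mid},d_E\big)\Big\},\end{aligned}$$ $$C_4=\tfrac{(m+3)\Xi_1\Xi_2}{4}\Big[\big(v_{\min}^{-\frac1q}-v_{\rm mid}^{-\frac1q}\big)\lambda\big(q,v_{\min},v_{\max},d_B\big)-\big(v_{\min}^{-\frac1q}-v_{\max}^{-\frac1q}\big)\lambda\big(q,v_{\min},v_{\rm mid},d_E\big)\Big].$$ -/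

import Mathlib

open MeasureTheory

noncomputable section

/-! ### The Meijer G-function -/

/-- The integrand (without the power `z ^ s`) of the Mellin-Barnes integral of `G^{m,n}_{p,q}`:
`∏_{j ≤ m} Γ(b_j - s) ∏_{j ≤ n} Γ(1 - a_j + s) / (∏_{j > m} Γ(1 - b_j + s) ∏_{j > n} Γ(a_j - s))`.
Lean's indices start at `0`. Since `Complex.Gamma` is `0` at its poles, each inverse below is the
entire function `1 / Γ`. -/
def meijerGKernel {p q : ℕ} (m n : ℕ) (a : Fin p → ℂ) (b : Fin q → ℂ) (s : ℂ) : ℂ :=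
  (∏ j : Fin q, if (j : ℕ) < m then Complex.Gamma (b j - s) else (Complex.Gamma (1 - b j + s))⁻¹) *
  (∏ j : Fin p, if (j : ℕ) < n then Complex.Gamma (1 - a j + s) else (Complex.Gamma (a j - s))⁻¹)

/-- The vertical line `re s = c` separates the poles `b_j, b_j + 1, …` of `Γ(b_j - s)`, `j ≤ m`
(on its right) from the poles `a_j - 1, a_j - 2, …` of `Γ(1 - a_j + s)`, `j ≤ n` (on its left). -/
def MeijerGSeparates {p q : ℕ} (m n : ℕ) (a : Fin p → ℂ) (b : Fin q → ℂ) (c : ℝ) : Prop :=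
  (∀ j : Fin q, (j : ℕ) < m → c < (b j).re) ∧ (∀ j : Fin p, (j : ℕ) < n → (a j).re - 1 < c)

/-- The Meijer G-function `G^{m,n}_{p,q}[z | a; b]`, as the Mellin-Barnes integral
`(2πi)⁻¹ ∫_L kernel(s) z ^ s ds` along an upward vertical line `L` that separates the two families
of poles (such a line exists for the parameters used below; by Cauchy's theorem it does
not matter which one is taken). With `s = c + i t` one has `(2πi)⁻¹ ds = (2π)⁻¹ dt`. -/
def meijerG {p q : ℕ} (m n : ℕ) (a : Fin p → ℂ) (b : Fin q → ℂ) (z : ℂ) : ℂ :=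
  let c : ℝ := Classical.epsilon (MeijerGSeparates m n a b)
  (2 * (Real.pi : ℂ))⁻¹ *
    ∫ t : ℝ, meijerGKernel m n a b ((c : ℂ) + t * Complex.I) * z ^ ((c : ℂ) + t * Complex.I)

/-! ### The random VLC network -/

/-- The receiver plane, with origin at the projection of the transmitter Alice. -/
abbrev ReceiverPlane : Type := EuclideanSpace ℝ (Fin 2)

/-- The deterministic parameters of the indoor VLC network. -/
structure VLCNetwork where
  /-- order of the Lambertian emission -/
  m : ℝ
  /-- physical area of the photodiode -/
  A : ℝ
  /-- optical filter gain -/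
  Ts : ℝ
  /-- concentrator gain -/
  g : ℝ
  /-- height of Alice above the receiver plane -/
  l : ℝ
  /-- radius of the receiver zone -/
  D : ℝ
  /-- radius of the protected zone -/
  ρ : ℝ
  /-- standard deviation of Bob's noise -/
  σB : ℝ
  /-- standard deviation of Eve's noise -/
  σE : ℝ
  /-- dimming target -/
  ξ : ℝ
  /-- nominal optical intensity of the LED -/
  P : ℝ
  /-- CSI uncertainty parameter of Bob -/
  ηB : ℝ
  /-- CSI uncertainty parameter of Eve -/
  ηE : ℝ
  m_pos : 0 < m
  A_pos : 0 < A
  Ts_pos : 0 < Ts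
  g_pos : 0 < g
  l_pos : 0 < l
  ρ_nonneg : 0 ≤ ρ
  ρ_lt_D : ρ < D
  σB_pos : 0 < σB
  σE_pos : 0 < σE
  ξ_pos : 0 < ξ
  ξ_le_one : ξ ≤ 1
  P_pos : 0 < P

namespace VLCNetwork

variable (N : VLCNetwork)

/-- The receiver zone: a disc of radius `D`. -/
def receiverZone : Set ReceiverPlane := Metric.closedBall 0 N.D

/-- The protected (eavesdropper-free) zone: the concentric disc of radius `ρ`. -/
def protectedZone : Set ReceiverPlane := Metric.closedBall 0 N.ρ

/-- The distance between Alice and a receiver at position `u`. -/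
def dist (u : ReceiverPlane) : ℝ := √(‖u‖ ^ 2 + N.l ^ 2)

/-- The cosine of the irradiance angle, and also of the incidence angle, at position `u`. -/
def cosAngle (u : ReceiverPlane) : ℝ := N.l / N.dist u

/-- The Lambertian channel gain of a receiver at position `u`. -/
def gain (u : ReceiverPlane) : ℝ :=
  (N.m + 1) * N.A / (2 * Real.pi * N.dist u ^ 2) * N.Ts * N.g * N.cosAngle u ^ N.m * N.cosAngle u

/-- The threshold `χ`. -/
def χ : ℝ :=
  (10 : ℝ) ^ ((N.ηB - N.ηE) / 10) * √(Real.exp 1) * N.σE / (√(2 * Real.pi) * N.σB)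

/-- The expression `C_s^+` as a function of the two channel gains. -/
def secrecyCapacityPlus (hB hE : ℝ) : ℝ :=
  1 / 2 * Real.log (N.σE ^ 2 / (2 * Real.pi * N.σB ^ 2) *
    ((Real.exp 1 * N.ξ ^ 2 * N.P ^ 2 * (10 : ℝ) ^ (N.ηB / 5) * hB ^ 2 + 2 * Real.pi * N.σB ^ 2) /
      ((10 : ℝ) ^ (N.ηE / 5) * hE ^ 2 * N.ξ ^ 2 * N.P ^ 2 + N.σE ^ 2)))

open Classical in
/-- The (lower bound on the) instantaneous secrecy capacity `C_s` under imperfect CSIR. -/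
def secrecyCapacity (hB hE : ℝ) : ℝ :=
  if hE ≤ N.χ * hB then N.secrecyCapacityPlus hB hE else 0

/-- The average secrecy capacity, when Bob and Eve are at the random positions `U` and `W`. -/
def averageSecrecyCapacity {Ω : Type*} [MeasurableSpace Ω] (μ : Measure Ω)
    (U W : Ω → ReceiverPlane) : ℝ :=
  ∫ ω, N.secrecyCapacity (N.gain (U ω)) (N.gain (W ω)) ∂μ

/-! ### The constants and the densities of the channel gains -/

/-- The constant `(m + 1) A T_s g l ^ (m + 1) / (2π)`. -/
def gainConst : ℝ :=
  (N.m + 1) * N.A * N.Ts * N.g * N.l ^ (N.m + 1) / (2 * Real.pi)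

/-- The smallest channel gain. -/
def vmin : ℝ := N.gainConst * (N.D ^ 2 + N.l ^ 2) ^ (-((N.m + 3) / 2))

/-- The channel gain at the border of the protected zone. -/
def vmid : ℝ := N.gainConst * (N.ρ ^ 2 + N.l ^ 2) ^ (-((N.m + 3) / 2))

/-- The largest channel gain. -/
def vmax : ℝ := N.gainConst * N.l ^ (-(N.m + 3))

/-- The constant `Ξ₁`. -/
def Ξ₁ : ℝ := 2 / ((N.m + 3) * N.D ^ 2) * N.gainConst ^ (2 / (N.m + 3))

/-- The constant `Ξ₂`. -/
def Ξ₂ : ℝ := 2 / ((N.m + 3) * (N.D ^ 2 - N.ρ ^ 2)) * N.gainConst ^ (2 / (N.m + 3))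

open Classical in
/-- The probability density of Bob's channel gain. -/
def pdfB (h : ℝ) : ℝ :=
  if N.vmin ≤ h ∧ h ≤ N.vmax then N.Ξ₁ * h ^ (-(2 / (N.m + 3)) - 1) else 0

open Classical in
/-- The probability density of Eve's channel gain. -/
def pdfE (h : ℝ) : ℝ :=
  if N.vmin ≤ h ∧ h ≤ N.vmid then N.Ξ₂ * h ^ (-(2 / (N.m + 3)) - 1) else 0

/-! ### The closed form -/

/-- The Meijer G-function `G^{1,3}_{3,3}[z | 1, 1, 1 + 1/(2a); 1, 1/(2a), 0]`. -/
def lamG (a z : ℝ) : ℂ :=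
  meijerG 1 3 ![1, 1, 1 + 1 / (2 * (a : ℂ))] ![1, 1 / (2 * (a : ℂ)), 0] (z : ℂ)

/-- The auxiliary function `λ(a, b, c, d)`. -/
def lam (a b c d : ℝ) : ℂ :=
  ((a * (b ^ (-(1 / a)) - c ^ (-(1 / a))) *
      Real.log (2 * Real.pi * N.σB ^ 2 * N.σE ^ 2) : ℝ) : ℂ)
    + 1 / 2 * ((c ^ (-(1 / a)) : ℝ) : ℂ) * lamG a (d * N.ξ ^ 2 * N.P ^ 2 * c ^ 2)
    - 1 / 2 * ((b ^ (-(1 / a)) : ℝ) : ℂ) * lamG a (d * N.ξ ^ 2 * N.P ^ 2 * b ^ 2)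

/-- The fourth argument of `λ` in the terms that belong to Bob. -/
def dB : ℝ := Real.exp 1 * (10 : ℝ) ^ (N.ηB / 5) / (2 * Real.pi * N.σB ^ 2)

/-- The fourth argument of `λ` in the terms that belong to Eve. -/
def dE : ℝ := (10 : ℝ) ^ (N.ηE / 5) / N.σE ^ 2

/-- The power `x ^ (-2 / (m + 3))`. -/
def npow (x : ℝ) : ℝ := x ^ (-(2 / (N.m + 3)))

/-- The common factor `(m + 3) Ξ₁ Ξ₂ / 4`. -/
def prefactor : ℝ := (N.m + 3) * N.Ξ₁ * N.Ξ₂ / 4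

/-- The value `C₁`. -/
def C₁ : ℂ :=
  (N.prefactor : ℂ) *
    ((N.npow N.vmin : ℂ) * N.lam ((N.m + 3) / 2) (N.vmin / N.χ) N.vmax N.dB
      - (N.npow N.χ : ℂ) * N.lam ((N.m + 3) / 4) (N.vmin / N.χ) N.vmax N.dB
      - ((N.χ ^ (2 / (N.m + 3)) : ℝ) : ℂ) * N.lam ((N.m + 3) / 4) N.vmin (N.χ * N.vmax) N.dE
      + (N.npow N.vmax : ℂ) * N.lam ((N.m + 3) / 2) N.vmin (N.χ * N.vmax) N.dE)

/-- The value `C₂`. -/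
def C₂ : ℂ :=
  (N.prefactor : ℂ) *
    ((N.npow N.vmin : ℂ) * N.lam ((N.m + 3) / 2) (N.vmin / N.χ) (N.vmid / N.χ) N.dB
      - (N.npow N.χ : ℂ) * N.lam ((N.m + 3) / 4) (N.vmin / N.χ) (N.vmid / N.χ) N.dB
      + ((N.npow N.vmin - N.npow N.vmid : ℝ) : ℂ)
          * N.lam ((N.m + 3) / 2) (N.vmid / N.χ) N.vmax N.dB
      - ((N.χ ^ (2 / (N.m + 3)) : ℝ) : ℂ) * N.lam ((N.m + 3) / 4) N.vmin N.vmid N.dE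
      + (N.npow N.vmax : ℂ) * N.lam ((N.m + 3) / 2) N.vmin N.vmid N.dE)

/-- The value `C₃`. -/
def C₃ : ℂ :=
  (N.prefactor : ℂ) *
    ((N.npow N.vmin : ℂ) * N.lam ((N.m + 3) / 2) N.vmin (N.vmid / N.χ) N.dB
      - (N.npow N.χ : ℂ) * N.lam ((N.m + 3) / 4) N.vmin (N.vmid / N.χ) N.dB
      - ((N.npow N.vmin - N.npow (N.vmid / N.χ) : ℝ) : ℂ)
          * N.lam ((N.m + 3) / 2) N.vmin (N.χ * N.vmin) N.dE
      - ((N.χ ^ (2 / (N.m + 3)) : ℝ) : ℂ) * N.lam ((N.m + 3) / 4) (N.χ * N.vmin) N.vmid N.dE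
      + (N.npow (N.vmid / N.χ) : ℂ) * N.lam ((N.m + 3) / 2) (N.χ * N.vmin) N.vmid N.dE
      + ((N.npow N.vmin - N.npow N.vmid : ℝ) : ℂ)
          * N.lam ((N.m + 3) / 2) (N.vmid / N.χ) N.vmax N.dB
      - ((N.npow (N.vmid / N.χ) - N.npow N.vmax : ℝ) : ℂ)
          * N.lam ((N.m + 3) / 2) N.vmin N.vmid N.dE)

/-- The value `C₄`. -/
def C₄ : ℂ :=
  (N.prefactor : ℂ) *
    (((N.npow N.vmin - N.npow N.vmid : ℝ) : ℂ) * N.lam ((N.m + 3) / 2) N.vmin N.vmax N.dB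
      - ((N.npow N.vmin - N.npow N.vmax : ℝ) : ℂ) * N.lam ((N.m + 3) / 2) N.vmin N.vmid N.dE)

end VLCNetwork

end

/-! The average is reduced to one-dimensional integrals, and `λ` is recognised as exactly such an
integral.

Analytic half: with β = 1/(2a), the Meijer kernel of `lamG` collapses, by Γ(u+1) = uΓ(u), to
Γ(s)Γ(1-s) / (s(s-β)). Up to s ↦ -s and a constant this is the Mellin transform of `logAverage
(1/a)`. Indeed Γ(s)Γ(1-s) belongs to 1/(1+x), multiplying by x shifts s, and each average over the
dilations Z ↦ t²Z contributes one linear factor in the denominator: the first average produces the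
logarithm, the second `logAverage`. Mellin inversion gives `lamG_eq_logAverage`. Rescaling t turns
the two G-terms of `λ(a,b,c,d)` into integrals from 0 to c and from 0 to b, so that `λ` is an
integral over [b, c] (`lam_eq_integral`).

Probabilistic half: polar coordinates and the substitution x = `gainAt r` give both gains power-law
densities (`integral_cond_annulus`), and independence makes the average a double integral over a
rectangle cut by the line y = χx. On it `C_s^+` is a function of x minus a function of y.
Integrating each term first in the variable it lacks leaves single integrals against powers
(`integral_truncated`). The five cases record which edges of the rectangle the line crosses. -/

/-! ### Mellin transforms of the averaged logarithm -/

-- Dilation by t² multiplies the Mellin transform by t^(-2s), so Fubini leaves ∫₀¹ t^(w-1-2s) dt =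
-- 1/(w-2s). The bound `hw` makes this integral converge absolutely. The values w = 0 and w = -r are
-- used below.
open Set in
theorem hasMellin_dilation_average {f : ℝ → ℂ} (hf : Measurable f) {s w : ℂ}
    (hw : 2 * s.re < w.re) (hfs : MellinConvergent f s) :
    HasMellin (fun Z : ℝ => ∫ t in Ioc (0 : ℝ) 1, (t : ℂ) ^ (w - 1) * f (t ^ 2 * Z)) s
      (mellin f s / (w - 2 * s)) := by
  set Φ : ℝ → ℝ → ℂ := fun Z t => (Z : ℂ) ^ (s - 1) * ((t : ℂ) ^ (w - 1) * f (t ^ 2 * Z)) with hΦ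
  have hmeas : Measurable (Function.uncurry Φ) := by
    simp only [hΦ, Function.uncurry_def]
    fun_prop
  have hint : Integrable (Function.uncurry Φ)
      ((volume.restrict (Ioi (0 : ℝ))).prod (volume.restrict (Ioc (0 : ℝ) 1))) := by
    rw [integrable_prod_iff' hmeas.aestronglyMeasurable]
    constructor
    · filter_upwards [ae_restrict_mem measurableSet_Ioc] with t ht
      have := ((MellinConvergent.comp_mul_left (a := t ^ 2) (pow_pos ht.1 2)).2 hfs)
      refine (Integrable.const_mul this ((t : ℂ) ^ (w - 1))).congr (Filter.Eventually.of_forall ?_)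
      intro Z
      simp only [Function.uncurry_apply_pair, hΦ, smul_eq_mul]
      ring
    · have key : ∀ t ∈ Ioc (0 : ℝ) 1, ∫ Z in Ioi (0 : ℝ), ‖Function.uncurry Φ (Z, t)‖
          = t ^ (w.re - 1 - 2 * s.re) * ∫ Z in Ioi (0 : ℝ), ‖(Z : ℂ) ^ (s - 1) * f Z‖ := by
        intro t ht
        have ht2 : 0 < t ^ 2 := pow_pos ht.1 2
        have h1 := integral_comp_mul_left_Ioi (fun Z : ℝ => ‖(Z : ℂ) ^ (s - 1) * f Z‖) 0 ht2
        rw [mul_zero] at h1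
        have hpt : ∀ Z ∈ Ioi (0 : ℝ), ‖Function.uncurry Φ (Z, t)‖ = t ^ (w.re - 1 - 2 * s.re) * t ^ 2
            * ‖((t ^ 2 * Z : ℝ) : ℂ) ^ (s - 1) * f (t ^ 2 * Z)‖ := by
          intro Z hZ
          have hZ' : (0 : ℝ) < Z := hZ
          simp only [Function.uncurry_apply_pair, hΦ, norm_mul]
          rw [Complex.norm_cpow_eq_rpow_re_of_pos hZ', Complex.norm_cpow_eq_rpow_re_of_pos ht.1,
            Complex.norm_cpow_eq_rpow_re_of_pos (mul_pos ht2 hZ'), Real.mul_rpow ht2.le hZ'.le,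
            ← Real.rpow_natCast, ← Real.rpow_mul ht.1.le]
          simp only [Complex.sub_re, Complex.one_re]
          have : t ^ (w.re - 1) = t ^ (w.re - 1 - 2 * s.re) * t ^ ((2 : ℕ) : ℝ)
              * t ^ (((2 : ℕ) : ℝ) * (s.re - 1)) := by
            rw [← Real.rpow_add ht.1, ← Real.rpow_add ht.1]
            congr 1
            push_cast
            ring
          rw [this]
          ring
        rw [setIntegral_congr_fun measurableSet_Ioi hpt, integral_const_mul, h1, smul_eq_mul,
          mul_assoc, mul_inv_cancel_left₀ ht2.ne']
      have hI : IntegrableOn (fun t : ℝ => t ^ (w.re - 1 - 2 * s.re)) (Ioc 0 1) := by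
        rw [← intervalIntegrable_iff_integrableOn_Ioc_of_le zero_le_one]
        exact intervalIntegral.intervalIntegrable_rpow' (by linarith)
      refine (hI.mul_const (∫ Z in Ioi (0 : ℝ), ‖(Z : ℂ) ^ (s - 1) * f Z‖)).congr ?_
      filter_upwards [ae_restrict_mem measurableSet_Ioc] with t ht
      exact (key t ht).symm
  have hinner : ∀ Z : ℝ, ∫ t in Ioc (0 : ℝ) 1, Φ Z t
      = (Z : ℂ) ^ (s - 1) • ∫ t in Ioc (0 : ℝ) 1, (t : ℂ) ^ (w - 1) * f (t ^ 2 * Z) := by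
    intro Z
    rw [smul_eq_mul, ← integral_const_mul]
  constructor
  · refine hint.integral_prod_left.congr (Filter.Eventually.of_forall fun Z => ?_)
    exact hinner Z
  · rw [mellin]
    simp_rw [← hinner]
    rw [integral_integral_swap hint]
    have key : ∀ t ∈ Ioc (0 : ℝ) 1, ∫ Z in Ioi (0 : ℝ), Φ Z t
        = (t : ℂ) ^ (w - 1 - 2 * s) * mellin f s := by
      intro t ht
      have h1 := mellin_comp_mul_left f s (pow_pos ht.1 2)
      have h2 : ∫ Z in Ioi (0 : ℝ), Φ Z t
          = (t : ℂ) ^ (w - 1) * mellin (fun Z => f (t ^ 2 * Z)) s := by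
        rw [mellin, ← integral_const_mul]
        congr 1
        ext Z
        simp only [hΦ, smul_eq_mul]
        ring
      have ht0 : (t : ℂ) ≠ 0 := by exact_mod_cast ht.1.ne'
      rw [h2, h1, smul_eq_mul, ← mul_assoc]
      congr 1
      rw [Complex.cpow_sub _ _ ht0, Complex.ofReal_pow, Complex.cpow_neg, div_eq_mul_inv,
        pow_two, Complex.mul_cpow_ofReal_nonneg ht.1.le ht.1.le, ← Complex.cpow_add _ _ ht0,
        ← div_eq_mul_inv, ← div_eq_mul_inv, ← Complex.cpow_sub _ _ ht0,
        ← Complex.cpow_sub _ _ ht0, two_mul]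
    rw [setIntegral_congr_fun measurableSet_Ioc key, integral_mul_const,
      ← intervalIntegral.integral_of_le zero_le_one, integral_cpow]
    · have h0 : w - 1 - 2 * s + 1 = w - 2 * s := by ring
      have h1 : w - 2 * s ≠ 0 := by
        intro h
        have := congrArg Complex.re h
        simp at this
        linarith
      rw [h0, Complex.ofReal_one, Complex.one_cpow, Complex.ofReal_zero, Complex.zero_cpow h1]
      ring
    · left
      simp
      linarith

-- Write 1/(1+x) as the integral of exp(-u(1+x)) over u > 0 and integrate in x first: this yields
-- Γ(s) u^(-s), and the remaining u-integral is Γ(1-s). The strip 0 < re s < 1 makes both converge.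
open Set in
theorem hasMellin_inv_one_add {s : ℂ} (h0 : 0 < s.re) (h1 : s.re < 1) :
    HasMellin (fun x : ℝ => ((1 + x : ℝ) : ℂ)⁻¹) s (Complex.Gamma s * Complex.Gamma (1 - s)) := by
  set Φ : ℝ → ℝ → ℂ := fun x u => (x : ℂ) ^ (s - 1) * Complex.exp (-(u * (1 + x))) with hΦ
  have hmeas : Measurable (Function.uncurry Φ) := by
    simp only [hΦ, Function.uncurry_def]
    fun_prop
  have hint : Integrable (Function.uncurry Φ)
      ((volume.restrict (Ioi (0 : ℝ))).prod (volume.restrict (Ioi (0 : ℝ)))) := by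
    rw [integrable_prod_iff' hmeas.aestronglyMeasurable]
    have hnorm : ∀ x ∈ Ioi (0 : ℝ), ∀ u : ℝ, ‖Φ x u‖
        = Real.exp (-u) * (x ^ (s.re - 1) * Real.exp (-(u * x))) := by
      intro x hx u
      rw [hΦ]
      simp only [norm_mul]
      rw [Complex.norm_cpow_eq_rpow_re_of_pos hx, Complex.norm_exp]
      simp only [Complex.sub_re, Complex.one_re]
      have : (-((u : ℂ) * (1 + x))).re = -u + -(u * x) := by simp; ring
      rw [this, Real.exp_add]
      ring
    constructor
    · filter_upwards [ae_restrict_mem measurableSet_Ioi] with u hu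
      have hI : IntegrableOn (fun x : ℝ => Real.exp (-u) * (x ^ (s.re - 1) * Real.exp (-(u * x))))
          (Ioi 0) := by
        have := integrableOn_rpow_mul_exp_neg_mul_rpow (s := s.re - 1) (p := 1) (b := u)
          (by linarith) one_pos hu
        simp only [Real.rpow_one, neg_mul] at this
        exact this.const_mul _
      refine Integrable.mono' hI ?_ ?_
      · exact (hmeas.comp (measurable_id.prodMk measurable_const)).aestronglyMeasurable
      · filter_upwards [ae_restrict_mem measurableSet_Ioi] with x hx
        exact (hnorm x hx u).le
    · have key : ∀ u ∈ Ioi (0 : ℝ), ∫ x in Ioi (0 : ℝ), ‖Function.uncurry Φ (x, u)‖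
          = Real.exp (-u) * u ^ ((1 - s.re) - 1) * Real.Gamma s.re := by
        intro u hu
        have hu' : (0 : ℝ) < u := hu
        simp only [Function.uncurry_apply_pair]
        rw [setIntegral_congr_fun measurableSet_Ioi (fun x hx => hnorm x hx u),
          integral_const_mul, Real.integral_rpow_mul_exp_neg_mul_Ioi h0 hu, one_div,
          Real.inv_rpow hu'.le, ← Real.rpow_neg hu'.le, mul_assoc]
        congr 3
        ring
      refine ((Real.GammaIntegral_convergent (s := 1 - s.re) (by linarith)).mul_const
        (Real.Gamma s.re)).congr ?_
      filter_upwards [ae_restrict_mem measurableSet_Ioi] with u hu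
      exact (key u hu).symm
  have hinner : ∀ x ∈ Ioi (0 : ℝ), ∫ u in Ioi (0 : ℝ), Φ x u
      = (x : ℂ) ^ (s - 1) • ((1 + x : ℝ) : ℂ)⁻¹ := by
    intro x hx
    have hx' : (0 : ℝ) < 1 + x := add_pos one_pos hx
    have := Complex.integral_cpow_mul_exp_neg_mul_Ioi (a := 1) (r := 1 + x) (by simp) hx'
    simp only [sub_self, Complex.cpow_zero, one_mul, Complex.cpow_one, Complex.Gamma_one,
      mul_one, one_div] at this
    rw [integral_const_mul, smul_eq_mul, ← this]
    congr 2
    ext u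
    push_cast
    ring_nf
  constructor
  · refine hint.integral_prod_left.congr ?_
    filter_upwards [ae_restrict_mem measurableSet_Ioi] with x hx
    exact hinner x hx
  · rw [mellin, ← setIntegral_congr_fun measurableSet_Ioi hinner, integral_integral_swap hint]
    have key : ∀ u ∈ Ioi (0 : ℝ), ∫ x in Ioi (0 : ℝ), Φ x u
        = Complex.Gamma s * (((Real.exp (-u) : ℝ) : ℂ) * (u : ℂ) ^ ((1 - s) - 1)) := by
      intro u hu
      have hu' : (0 : ℝ) < u := hu
      have h := Complex.integral_cpow_mul_exp_neg_mul_Ioi h0 hu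
      have h2 : ∫ x in Ioi (0 : ℝ), Φ x u = ((Real.exp (-u) : ℝ) : ℂ) *
          ∫ x in Ioi (0 : ℝ), (x : ℂ) ^ (s - 1) * Complex.exp (-(u * x)) := by
        rw [← integral_const_mul]
        congr 1
        ext x
        simp only [hΦ]
        rw [mul_left_comm, Complex.ofReal_exp, ← Complex.exp_add]
        congr 2
        push_cast
        ring
      have h3 : (1 / (u : ℂ)) ^ s = (u : ℂ) ^ ((1 - s) - 1) := by
        rw [one_div, ← Complex.ofReal_inv, Complex.ofReal_inv,
          Complex.inv_cpow _ _ (by rw [Complex.arg_ofReal_of_nonneg hu'.le]; exact Real.pi_pos.ne),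
          ← Complex.cpow_neg]
        congr 1
        ring
      rw [h2, h, h3]
      ring
    rw [setIntegral_congr_fun measurableSet_Ioi key, integral_const_mul]
    congr 1
    rw [Complex.Gamma_eq_integral (by simpa using h1)]
    rfl

theorem HasMellin.congr_Ioi {f g : ℝ → ℂ} {s m : ℂ} (hf : HasMellin f s m)
    (h : ∀ x, 0 < x → f x = g x) : HasMellin g s m := by
  constructor
  · exact hf.1.congr_fun (fun x hx => by simp only [h x hx]) measurableSet_Ioi
  · rw [← hf.2]
    exact setIntegral_congr_fun measurableSet_Ioi (fun x hx => by simp only [h x hx])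

theorem hasMellin_div_one_add {s : ℂ} (h0 : -1 < s.re) (h1 : s.re < 0) :
    HasMellin (fun x : ℝ => ((x / (1 + x) : ℝ) : ℂ)) s
      (Complex.Gamma (s + 1) * Complex.Gamma (-s)) := by
  have h := hasMellin_inv_one_add (s := s + 1) (by simp; linarith) (by simpa using h1)
  have h2 : HasMellin (fun x : ℝ => (x : ℂ) ^ (1 : ℂ) • ((1 + x : ℝ) : ℂ)⁻¹) s
      (Complex.Gamma (s + 1) * Complex.Gamma (-s)) := by
    refine ⟨MellinConvergent.cpow_smul.2 h.1, ?_⟩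
    rw [mellin_cpow_smul, h.2]
    congr 2
    ring
  refine h2.congr_Ioi fun x _ => ?_
  rw [Complex.cpow_one, smul_eq_mul, Complex.ofReal_div, div_eq_mul_inv]

theorem integral_mul_div_one_add_sq {Z : ℝ} (hZ : 0 < Z) :
    ∫ t in (0 : ℝ)..1, t * Z / (1 + t ^ 2 * Z) = Real.log (1 + Z) / 2 := by
  have hpos : ∀ t : ℝ, 0 < 1 + t ^ 2 * Z := fun t => by positivity
  have hd : ∀ t ∈ Set.uIcc (0 : ℝ) 1,
      HasDerivAt (fun t => Real.log (1 + t ^ 2 * Z) / 2) (t * Z / (1 + t ^ 2 * Z)) t := by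
    intro t _
    have h1 : HasDerivAt (fun t : ℝ => 1 + t ^ 2 * Z) (2 * t * Z) t := by
      simpa using ((hasDerivAt_pow 2 t).mul_const Z).const_add 1
    refine ((h1.log (hpos t).ne').div_const 2).congr_deriv ?_
    ring
  rw [intervalIntegral.integral_eq_sub_of_hasDerivAt hd]
  · simp
  · refine Continuous.intervalIntegrable ?_ _ _
    exact Continuous.div (by fun_prop) (by fun_prop) fun t => (hpos t).ne'

/-- The function log(1+Z)/2 is the dilation average of x/(1+x) with w = 0. -/
theorem hasMellin_log_one_add {s : ℂ} (h0 : -1 < s.re) (h1 : s.re < 0) :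
    HasMellin (fun x : ℝ => ((Real.log (1 + x) / 2 : ℝ) : ℂ)) s
      (Complex.Gamma (s + 1) * Complex.Gamma (-s) / (-(2 * s))) := by
  have hf := hasMellin_div_one_add h0 h1
  have h := hasMellin_dilation_average (f := fun x : ℝ => ((x / (1 + x) : ℝ) : ℂ))
    (by fun_prop) (s := s) (w := 0) (by simp; linarith) hf.1
  rw [hf.2, zero_sub (2 * s)] at h
  refine h.congr_Ioi fun Z hZ => ?_
  rw [← integral_mul_div_one_add_sq hZ, ← intervalIntegral.integral_of_le zero_le_one,
    ← intervalIntegral.integral_ofReal]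
  refine intervalIntegral.integral_congr_ae (Filter.Eventually.of_forall fun t ht => ?_)
  rw [Set.uIoc_of_le zero_le_one] at ht
  have ht0 : (t : ℂ) ≠ 0 := by exact_mod_cast ht.1.ne'
  rw [zero_sub, Complex.cpow_neg_one]
  push_cast
  field_simp

/-- Twice this function is the Meijer G-function of `lamG`. -/
noncomputable def logAverage (r Z : ℝ) : ℝ := ∫ t in (0 : ℝ)..1, t ^ (-r - 1) * Real.log (1 + t ^ 2 * Z)

/-- A second dilation average, now with w = -r. The factor 2 undoes the half in front of the
logarithm. The strip -1 < re s < -r/2 is nonempty only for r < 2. -/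
theorem hasMellin_logAverage {r : ℝ} {s : ℂ} (hr : 0 < r) (h0 : -1 < s.re)
    (h1 : 2 * s.re < -r) :
    HasMellin (fun Z : ℝ => (logAverage r Z : ℂ)) s
      (Complex.Gamma (s + 1) * Complex.Gamma (-s) / (-(2 * s)) / (-r - 2 * s) * 2) := by
  have hf := hasMellin_log_one_add h0 (by linarith)
  have h := hasMellin_dilation_average (f := fun x : ℝ => ((Real.log (1 + x) / 2 : ℝ) : ℂ))
    (by fun_prop) (s := s) (w := -r) (by simpa using h1) hf.1
  rw [hf.2] at h
  have h2 := hasMellin_const_smul h.1 (2 : ℂ)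
  rw [h.2, smul_eq_mul, mul_comm] at h2
  refine h2.congr_Ioi fun Z hZ => ?_
  rw [logAverage, ← intervalIntegral.integral_of_le zero_le_one,
    ← intervalIntegral.integral_ofReal, smul_eq_mul, ← intervalIntegral.integral_const_mul]
  refine intervalIntegral.integral_congr_ae (Filter.Eventually.of_forall fun t ht => ?_)
  rw [Set.uIoc_of_le zero_le_one] at ht
  rw [Complex.ofReal_mul, Complex.ofReal_cpow ht.1.le]
  push_cast
  ring

theorem abs_log_one_add_le {x : ℝ} (hx : 0 ≤ x) : |Real.log (1 + x)| ≤ x := by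
  rw [abs_of_nonneg (Real.log_nonneg (by linarith))]
  have := Real.log_le_sub_one_of_pos (x := 1 + x) (by linarith)
  linarith

/-- Needed for pointwise Mellin inversion. The bound log(1+x) ≤ x dominates the integrand by a
multiple of t^(1-r), which is integrable because r < 2. -/
theorem continuousAt_logAverage {r Z : ℝ} (hr : r < 2) (hZ : 0 < Z) :
    ContinuousAt (logAverage r) Z := by
  refine intervalIntegral.continuousAt_of_dominated_interval
    (bound := fun t => t ^ (1 - r) * (Z + 1)) ?_ ?_ ?_ ?_
  · exact Filter.Eventually.of_forall fun x => by fun_prop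
  · filter_upwards [Ioo_mem_nhds hZ (lt_add_one Z)] with x hx
    refine Filter.Eventually.of_forall fun t ht => ?_
    rw [Set.uIoc_of_le zero_le_one] at ht
    have hx0 : 0 ≤ t ^ 2 * x := mul_nonneg (sq_nonneg t) hx.1.le
    rw [norm_mul, Real.norm_of_nonneg (Real.rpow_nonneg ht.1.le _), Real.norm_eq_abs]
    calc t ^ (-r - 1) * |Real.log (1 + t ^ 2 * x)| ≤ t ^ (-r - 1) * (t ^ 2 * x) := by
          gcongr
          · exact Real.rpow_nonneg ht.1.le _
          · exact abs_log_one_add_le hx0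
      _ = t ^ (1 - r) * x := by
          rw [← mul_assoc, ← Real.rpow_natCast, ← Real.rpow_add ht.1]
          congr 2
          push_cast
          ring
      _ ≤ t ^ (1 - r) * (Z + 1) := by
          gcongr
          · exact Real.rpow_nonneg ht.1.le _
          · exact hx.2.le
  · exact (intervalIntegral.intervalIntegrable_rpow' (by linarith)).mul_const _
  · refine Filter.Eventually.of_forall fun t ht => ?_
    have : 1 + t ^ 2 * Z ≠ 0 := by positivity
    fun_prop (disch := assumption)

/-! ### Mellin inversion and the Meijer G-function -/

theorem Complex.sin_re_le_norm_sin {z : ℂ} (h : 0 ≤ Real.sin z.re) :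
    Real.sin z.re ≤ ‖Complex.sin z‖ := by
  have h1 : (Complex.sin z).re = Real.sin z.re * Real.cosh z.im := by
    rw [Complex.sin_eq z, Complex.add_re, ← Complex.ofReal_sin, ← Complex.ofReal_cosh,
      ← Complex.ofReal_cos, ← Complex.ofReal_sinh, ← Complex.ofReal_mul, ← Complex.ofReal_mul,
      Complex.ofReal_re, Complex.re_ofReal_mul, Complex.I_re, mul_zero, add_zero]
  calc Real.sin z.re ≤ Real.sin z.re * Real.cosh z.im :=
        le_mul_of_one_le_right h (Real.one_le_cosh _)
    _ ≤ ‖Complex.sin z‖ := h1 ▸ Complex.re_le_norm _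

/-- The reflection formula turns the Gamma product into π/sin, bounded on the line because πc lies
in (0, π). The two linear factors from the averages supply the decay 1/(1+y²). -/
theorem verticalIntegrable_mellin_logAverage {r c : ℝ} (hr : 0 < r) (hc : c < 1)
    (hrc : r < 2 * c) :
    Complex.VerticalIntegrable (mellin fun Z : ℝ => (logAverage r Z : ℂ)) (-c) := by
  have hc0 : 0 < c := by linarith
  have heq : ∀ y : ℝ, mellin (fun Z : ℝ => (logAverage r Z : ℂ)) ((-c : ℝ) + y * Complex.I)
      = Real.pi / Complex.sin (Real.pi * (c - y * Complex.I)) / (2 * (c - y * Complex.I))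
        / (2 * (c - y * Complex.I) - r) * 2 := by
    intro y
    rw [(hasMellin_logAverage hr (by simp; linarith) (by simp; linarith)).2,
      ← Complex.Gamma_mul_Gamma_one_sub]
    have e1 : ((-c : ℝ) : ℂ) + y * Complex.I + 1 = 1 - (c - y * Complex.I) := by push_cast; ring
    have e2 : -(((-c : ℝ) : ℂ) + y * Complex.I) = c - y * Complex.I := by push_cast; ring
    have e3 : -(2 * (((-c : ℝ) : ℂ) + y * Complex.I)) = 2 * (c - y * Complex.I) := by
      push_cast; ring
    have e4 : -(r : ℂ) - 2 * (((-c : ℝ) : ℂ) + y * Complex.I) = 2 * (c - y * Complex.I) - r := by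
      push_cast; ring
    rw [e1, e2, e3, e4]
    ring
  rw [Complex.VerticalIntegrable]
  simp_rw [heq]
  -- Half the real part of the factor 2(c-iy) - r. Since δ ≤ c and δ < 1, the one bound δ√(1+y²)
  -- serves both linear factors.
  set δ := c - r / 2 with hδ
  have hδ0 : 0 < δ := by rw [hδ]; linarith
  have hδ1 : δ < 1 := by rw [hδ]; linarith
  have hsin : 0 < Real.sin (Real.pi * c) :=
    Real.sin_pos_of_pos_of_lt_pi (by positivity) (by nlinarith [Real.pi_pos])
  have hbd : Integrable fun y : ℝ => Real.pi / Real.sin (Real.pi * c) / 2 / δ ^ 2 *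
      (1 + y ^ 2)⁻¹ := integrable_inv_one_add_sq.const_mul _
  refine hbd.mono' (Measurable.aestronglyMeasurable (by fun_prop)) (Filter.Eventually.of_forall fun y => ?_)
  have hnorm : ∀ u : ℝ, δ ≤ u → δ * √(1 + y ^ 2) ≤ ‖(u - y * Complex.I : ℂ)‖ := by
    intro u hu
    have : ‖(u - y * Complex.I : ℂ)‖ = √(u ^ 2 + y ^ 2) := by
      have h := Complex.norm_add_mul_I u (-y)
      rw [← neg_sq y, ← h]
      push_cast
      ring_nf
    rw [this]
    apply Real.le_sqrt_of_sq_le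
    rw [mul_pow, Real.sq_sqrt (by positivity)]
    have : δ ^ 2 ≤ 1 := by nlinarith
    nlinarith [sq_nonneg y, mul_nonneg (sq_nonneg y) (sub_nonneg.2 this)]
  have hs : Real.sin (Real.pi * c) ≤ ‖Complex.sin (Real.pi * (c - y * Complex.I))‖ := by
    have hre : ((Real.pi : ℂ) * (c - y * Complex.I)).re = Real.pi * c := by simp
    have := Complex.sin_re_le_norm_sin (z := (Real.pi : ℂ) * (c - y * Complex.I))
      (by rw [hre]; exact hsin.le)
    rwa [hre] at this
  have e5 : (2 * ((c : ℂ) - y * Complex.I) - r) = 2 * ((δ : ℂ) - y * Complex.I) := by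
    rw [hδ]; push_cast; ring
  have h1 := hnorm c (by rw [hδ]; linarith)
  have h2 := hnorm δ le_rfl
  have hq : 0 < √(1 + y ^ 2) := by positivity
  rw [e5]
  simp only [norm_mul, norm_div, Complex.norm_real, Complex.norm_ofNat,
    Real.norm_of_nonneg Real.pi_pos.le]
  calc Real.pi / ‖Complex.sin (Real.pi * (c - y * Complex.I))‖ / (2 * ‖(c - y * Complex.I : ℂ)‖)
        / (2 * ‖(δ - y * Complex.I : ℂ)‖) * 2
      ≤ Real.pi / Real.sin (Real.pi * c) / (2 * (δ * √(1 + y ^ 2)))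
        / (2 * (δ * √(1 + y ^ 2))) * 2 := by gcongr
    _ = Real.pi / Real.sin (Real.pi * c) / 2 / δ ^ 2 * (√(1 + y ^ 2) ^ 2)⁻¹ := by
        field_simp
    _ = _ := by rw [Real.sq_sqrt (by positivity)]

/-- The functional equation reduces the shifted Gammas in the denominator to those in the numerator.
The nonvanishing hypotheses permit cancelling them. -/
theorem meijerGKernel_lamG {a : ℝ} {s : ℂ} (h0 : s ≠ 0) (h1 : s - 1 / (2 * a) ≠ 0)
    (h2 : Complex.Gamma s ≠ 0) (h3 : Complex.Gamma (s - 1 / (2 * a)) ≠ 0) :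
    meijerGKernel 1 3 ![1, 1, 1 + 1 / (2 * (a : ℂ))] ![1, 1 / (2 * (a : ℂ)), 0] s
      = Complex.Gamma s * Complex.Gamma (1 - s) / s / (s - 1 / (2 * a)) := by
  have e1 : 1 - 1 / (2 * (a : ℂ)) + s = s - 1 / (2 * a) + 1 := by ring
  have e2 : 1 - (1 + 1 / (2 * (a : ℂ))) + s = s - 1 / (2 * a) := by ring
  have e3 : (1 : ℂ) - 0 + s = s + 1 := by ring
  have e4 : (1 : ℂ) - 1 + s = s := by ring
  simp only [meijerGKernel, Fin.prod_univ_three, Matrix.cons_val_zero, Matrix.cons_val_one,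
    Matrix.cons_val, Fin.val_zero, Fin.val_one, Fin.val_two]
  simp only [Nat.lt_irrefl, if_false, Nat.zero_lt_one, if_true, show ¬ (2 < 1) by norm_num,
    show 0 < 3 by norm_num, show 1 < 3 by norm_num, show 2 < 3 by norm_num, e1, e2, e3, e4,
    Complex.Gamma_add_one _ h0, Complex.Gamma_add_one _ h1]
  generalize s - 1 / (2 * (a : ℂ)) = u at *
  field_simp

theorem lamG_eq_logAverage {a Z : ℝ} (ha : 1 < 2 * a) (hZ : 0 < Z) :
    VLCNetwork.lamG a Z = ((2 * logAverage (1 / a) Z : ℝ) : ℂ) := by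
  have ha0 : 0 < a := by linarith
  have hβ : ((1 / (2 * (a : ℂ)) : ℂ)) = ((1 / (2 * a) : ℝ) : ℂ) := by push_cast; ring
  have hβ0 : 0 < 1 / (2 * a) := by positivity
  have hβ1 : 1 / (2 * a) < 1 := by rw [div_lt_one (by linarith)]; exact ha
  rw [VLCNetwork.lamG, meijerG]
  set c : ℝ := Classical.epsilon
    (MeijerGSeparates 1 3 ![1, 1, 1 + 1 / (2 * (a : ℂ))] ![1, 1 / (2 * (a : ℂ)), 0]) with hc
  have hsep : MeijerGSeparates 1 3 ![1, 1, 1 + 1 / (2 * (a : ℂ))] ![1, 1 / (2 * (a : ℂ)), 0] c := by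
    -- Separation means max(0, β) < c < 1 with β = 1/(2a) in (0, 1); the midpoint of (β, 1)
    -- qualifies.
    refine Classical.epsilon_spec (p := MeijerGSeparates 1 3 ![1, 1, 1 + 1 / (2 * (a : ℂ))]
      ![1, 1 / (2 * (a : ℂ)), 0]) ⟨(1 / (2 * a) + 1) / 2, ?_, ?_⟩
    · intro j hj
      obtain rfl : j = 0 := Fin.ext (Nat.lt_one_iff.1 hj)
      simp only [Matrix.cons_val_zero, Complex.one_re]
      linarith
    · intro j _
      rw [hβ]
      fin_cases j
      · simp only [Fin.zero_eta, Matrix.cons_val_zero, Complex.one_re]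
        linarith
      · simp only [Fin.mk_one, Matrix.cons_val_one, Matrix.cons_val_zero, Complex.one_re]
        linarith
      · simp only [Fin.reduceFinMk, Matrix.cons_val, Complex.add_re, Complex.one_re,
          Complex.ofReal_re]
        linarith
  have hc1 : c < 1 := by simpa using hsep.1 0 (by norm_num)
  have hcβ : 1 / (2 * a) < c := by
    have := hsep.2 2 (by norm_num)
    rw [hβ] at this
    simp only [Matrix.cons_val, Complex.add_re, Complex.one_re, Complex.ofReal_re] at this
    linarith
  -- Only β < c < 1 is used from here on, so any separating line gives the same value.
  clear_value c
  have hr : 1 / a = 2 * (1 / (2 * a)) := by field_simp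
  have hr0 : 0 < 1 / a := by positivity
  have hinv := mellinInv_mellin_eq (-c) (fun Z : ℝ => (logAverage (1 / a) Z : ℂ)) hZ
    (hasMellin_logAverage hr0 (by simpa using hc1) (by simp only [Complex.ofReal_re]; linarith)).1
    (verticalIntegrable_mellin_logAverage hr0 hc1 (by linarith))
    (Complex.continuous_ofReal.continuousAt.comp (continuousAt_logAverage (by linarith) hZ))
  have hkernel : ∀ t : ℝ, meijerGKernel 1 3 ![1, 1, 1 + 1 / (2 * (a : ℂ))]
      ![1, 1 / (2 * (a : ℂ)), 0] (c + t * Complex.I) * (Z : ℂ) ^ ((c : ℂ) + t * Complex.I)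
      = 2 * ((Z : ℂ) ^ (-(((-c : ℝ) : ℂ) + ((-t : ℝ) : ℂ) * Complex.I)) •
        mellin (fun Z : ℝ => (logAverage (1 / a) Z : ℂ))
          (((-c : ℝ) : ℂ) + ((-t : ℝ) : ℂ) * Complex.I)) := by
    intro t
    set s : ℂ := c + t * Complex.I with hs
    have hsre : s.re = c := by simp [hs]
    have hs0 : s ≠ 0 := by
      intro h
      rw [h, Complex.zero_re] at hsre
      linarith
    have hdre : (s - 1 / (2 * a)).re = c - 1 / (2 * a) := by
      rw [hβ, Complex.sub_re, hsre, Complex.ofReal_re]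
    have hd0 : s - 1 / (2 * a) ≠ 0 := by
      intro h
      rw [h, Complex.zero_re] at hdre
      linarith
    have e1 : ((-c : ℝ) : ℂ) + ((-t : ℝ) : ℂ) * Complex.I = -s := by rw [hs]; push_cast; ring
    rw [meijerGKernel_lamG hs0 hd0 (Complex.Gamma_ne_zero_of_re_pos (by linarith))
      (Complex.Gamma_ne_zero_of_re_pos (by linarith)), e1, neg_neg,
      (hasMellin_logAverage hr0 (by rw [Complex.neg_re]; linarith)
        (by rw [Complex.neg_re]; linarith)).2, smul_eq_mul]
    have e2 : -((1 / a : ℝ) : ℂ) - 2 * -s = 2 * (s - 1 / (2 * a)) := by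
      rw [hr]; push_cast; ring
    rw [e2, neg_neg, neg_add_eq_sub]
    field_simp
  simp_rw [hkernel]
  -- The Meijer variable is minus the Mellin variable, so the line is traversed backwards; the
  -- substitution t ↦ -t restores the orientation.
  rw [integral_const_mul, integral_neg_eq_self (fun t : ℝ =>
    (Z : ℂ) ^ (-(((-c : ℝ) : ℂ) + (t : ℂ) * Complex.I)) •
      mellin (fun Z : ℝ => (logAverage (1 / a) Z : ℂ)) (((-c : ℝ) : ℂ) + (t : ℂ) * Complex.I)),
    Complex.ofReal_mul, ← hinv, mellinInv, Complex.real_smul]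
  push_cast
  ring

/-! ### The function `λ` as an integral -/

theorem rpow_mul_logAverage {r k c : ℝ} (hc : 0 < c) :
    c ^ (-r) * logAverage r (k * c ^ 2)
      = ∫ x in (0 : ℝ)..c, x ^ (-r - 1) * Real.log (1 + k * x ^ 2) := by
  have h := intervalIntegral.integral_comp_mul_left (a := 0) (b := 1)
    (fun x : ℝ => x ^ (-r - 1) * Real.log (1 + k * x ^ 2)) hc.ne'
  rw [mul_zero, mul_one, smul_eq_mul, eq_inv_mul_iff_mul_eq₀ hc.ne'] at h
  rw [← h, logAverage, ← intervalIntegral.integral_const_mul,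
    ← intervalIntegral.integral_const_mul]
  refine intervalIntegral.integral_congr_ae (Filter.Eventually.of_forall fun t ht => ?_)
  rw [Set.uIoc_of_le zero_le_one] at ht
  have : c ^ (-r) = c * c ^ (-r - 1) := by
    nth_rw 2 [← Real.rpow_one c]
    rw [← Real.rpow_add hc]
    congr 1
    ring
  rw [Real.mul_rpow hc.le ht.1.le, this]
  ring_nf

theorem intervalIntegrable_rpow_mul_log {r k c : ℝ} (hr : r < 2) (hk : 0 ≤ k) (hc : 0 < c) :
    IntervalIntegrable (fun x : ℝ => x ^ (-r - 1) * Real.log (1 + k * x ^ 2)) volume 0 c := by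
  have hb : IntervalIntegrable (fun x : ℝ => x ^ (1 - r) * k) volume 0 c :=
    (intervalIntegral.intervalIntegrable_rpow' (by linarith)).mul_const _
  refine hb.mono_fun (Measurable.aestronglyMeasurable (by fun_prop)) ?_
  rw [Set.uIoc_of_le hc.le]
  filter_upwards [ae_restrict_mem measurableSet_Ioc] with x hx
  have hx0 : 0 < x := hx.1
  rw [norm_mul, Real.norm_of_nonneg (Real.rpow_nonneg hx0.le _), Real.norm_eq_abs,
    Real.norm_of_nonneg (by positivity)]
  calc x ^ (-r - 1) * |Real.log (1 + k * x ^ 2)| ≤ x ^ (-r - 1) * (k * x ^ 2) := by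
        gcongr
        exact abs_log_one_add_le (by positivity)
    _ = x ^ (1 - r) * k := by
        rw [mul_left_comm, ← Real.rpow_natCast, ← Real.rpow_add hx0, mul_comm]
        congr 2
        push_cast
        ring

/-- The logarithm whose half is one of the two terms of `C_s^+`. -/
noncomputable def VLCNetwork.logTerm (N : VLCNetwork) (d x : ℝ) : ℝ :=
  Real.log (2 * Real.pi * N.σB ^ 2 * N.σE ^ 2) + Real.log (1 + d * N.ξ ^ 2 * N.P ^ 2 * x ^ 2)

/-- The first summand of `λ` integrates the constant in `logTerm`. The G-terms are integrals
starting at 0, which converge because 1/a < 2, and their difference is the integral from b to c. -/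
theorem VLCNetwork.lam_eq_integral (N : VLCNetwork) {a b c d : ℝ} (ha : 1 < 2 * a) (hb : 0 < b)
    (hc : 0 < c) (hd : 0 < d) :
    N.lam a b c d = ((∫ x in b..c, x ^ (-(1 / a) - 1) * N.logTerm d x : ℝ) : ℂ) := by
  have ha0 : 0 < a := by linarith
  have hk : 0 < d * N.ξ ^ 2 * N.P ^ 2 :=
    mul_pos (mul_pos hd (pow_pos N.ξ_pos 2)) (pow_pos N.P_pos 2)
  have hr : 1 / a < 2 := by rw [div_lt_iff₀ ha0]; exact ha
  have hnot : (0 : ℝ) ∉ Set.uIcc b c := Set.notMem_uIcc_of_lt hb hc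
  have hne : -(1 / a) - 1 ≠ -1 := by
    have : 0 < 1 / a := by positivity
    linarith
  rw [lam, lamG_eq_logAverage ha (by positivity), lamG_eq_logAverage ha (by positivity)]
  have hIb := intervalIntegrable_rpow_mul_log hr hk.le hb
  have hIc := intervalIntegrable_rpow_mul_log hr hk.le hc
  have key : ∫ x in b..c, x ^ (-(1 / a) - 1) * N.logTerm d x
      = a * (b ^ (-(1 / a)) - c ^ (-(1 / a))) * Real.log (2 * Real.pi * N.σB ^ 2 * N.σE ^ 2)
        + c ^ (-(1 / a)) * logAverage (1 / a) (d * N.ξ ^ 2 * N.P ^ 2 * c ^ 2)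
        - b ^ (-(1 / a)) * logAverage (1 / a) (d * N.ξ ^ 2 * N.P ^ 2 * b ^ 2) := by
    rw [rpow_mul_logAverage hc, rpow_mul_logAverage hb, add_sub_assoc,
      intervalIntegral.integral_interval_sub_left hIc hIb]
    simp only [logTerm, mul_add]
    rw [intervalIntegral.integral_add _ (hIb.symm.trans hIc), intervalIntegral.integral_mul_const,
      integral_rpow (Or.inr ⟨hne, hnot⟩)]
    · congr 2
      rw [sub_add_cancel, div_neg, div_div_eq_mul_div, div_one]
      ring
    · exact (intervalIntegral.intervalIntegrable_rpow (Or.inr hnot)).mul_const _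
  rw [key]
  push_cast
  ring

/-! ### Polar coordinates and the laws of the channel gains -/

theorem setIntegral_norm_receiverPlane {I : Set ℝ} (hI : MeasurableSet I) (f : ℝ → ℝ) :
    ∫ u in (norm : ReceiverPlane → ℝ) ⁻¹' I, f ‖u‖
      = 2 * Real.pi * ∫ r in Set.Ioi 0 ∩ I, r * f r := by
  have h := integral_fun_norm_addHaar (volume : Measure ReceiverPlane) (I.indicator f)
  have h1 : ∀ u : ReceiverPlane, I.indicator f ‖u‖
      = ((norm : ReceiverPlane → ℝ) ⁻¹' I).indicator (fun u => f ‖u‖) u := fun u => rfl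
  have h2 : ∀ r : ℝ, r ^ (Module.finrank ℝ ReceiverPlane - 1) • I.indicator f r
      = I.indicator (fun r => r * f r) r := by
    intro r
    rw [finrank_euclideanSpace_fin]
    by_cases hr : r ∈ I <;> simp [hr]
  simp_rw [h1, h2] at h
  rw [integral_indicator (measurable_norm hI), setIntegral_indicator hI] at h
  rw [h, finrank_euclideanSpace_fin, measureReal_def, EuclideanSpace.volume_ball_fin_two]
  simp [Real.pi_pos.le]
  ring

namespace VLCNetwork

variable (N : VLCNetwork)

theorem gainConst_pos : 0 < N.gainConst := by
  have := N.m_pos; have := N.A_pos; have := N.Ts_pos; have := N.g_pos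
  have := Real.rpow_pos_of_pos N.l_pos (N.m + 1)
  rw [gainConst]
  positivity

/-- The channel gain at horizontal distance `r` from the transmitter. -/
noncomputable def gainAt (r : ℝ) : ℝ := N.gainConst * (r ^ 2 + N.l ^ 2) ^ (-((N.m + 3) / 2))

theorem sq_add_sq_pos (r : ℝ) : 0 < r ^ 2 + N.l ^ 2 :=
  add_pos_of_nonneg_of_pos (sq_nonneg r) (pow_pos N.l_pos 2)

theorem gainAt_pos (r : ℝ) : 0 < N.gainAt r :=
  mul_pos N.gainConst_pos (Real.rpow_pos_of_pos (N.sq_add_sq_pos r) _)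

theorem gain_eq_gainAt (u : ReceiverPlane) : N.gain u = N.gainAt ‖u‖ := by
  have hs := N.sq_add_sq_pos ‖u‖
  have hd : 0 < N.dist u := Real.sqrt_pos.2 hs
  have hd2 : ‖u‖ ^ 2 + N.l ^ 2 = N.dist u ^ 2 := (Real.sq_sqrt hs.le).symm
  have e1 : (N.dist u ^ 2) ^ (-((N.m + 3) / 2)) = (N.dist u ^ N.m * N.dist u ^ 3)⁻¹ := by
    rw [← Real.rpow_natCast, ← Real.rpow_mul hd.le, ← Real.rpow_natCast (N.dist u) 3,
      ← Real.rpow_add hd, ← Real.rpow_neg hd.le]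
    congr 1
    push_cast
    ring
  have := Real.rpow_pos_of_pos hd N.m
  rw [gain, gainAt, gainConst, cosAngle, hd2, e1, Real.div_rpow N.l_pos.le hd.le,
    Real.rpow_add_one N.l_pos.ne']
  field_simp

theorem antitoneOn_gainAt : AntitoneOn N.gainAt (Set.Ici 0) := by
  intro r hr s _ hrs
  have hr0 : (0 : ℝ) ≤ r := hr
  have := N.m_pos
  refine mul_le_mul_of_nonneg_left ?_ N.gainConst_pos.le
  exact Real.rpow_le_rpow_of_nonpos (N.sq_add_sq_pos r) (by gcongr) (by linarith)

theorem gainAt_lt {r s : ℝ} (hr : 0 ≤ r) (h : r < s) : N.gainAt s < N.gainAt r := by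
  have := N.m_pos
  refine mul_lt_mul_of_pos_left ?_ N.gainConst_pos
  exact Real.rpow_lt_rpow_of_neg (N.sq_add_sq_pos r) (by gcongr) (by linarith)

theorem vmin_eq : N.vmin = N.gainAt N.D := rfl

theorem vmid_eq : N.vmid = N.gainAt N.ρ := rfl

theorem vmax_eq : N.vmax = N.gainAt 0 := by
  rw [vmax, gainAt, zero_pow two_ne_zero, zero_add, ← Real.rpow_natCast,
    ← Real.rpow_mul N.l_pos.le]
  congr 2
  push_cast
  ring

theorem vmin_pos : 0 < N.vmin := N.gainAt_pos _

theorem vmin_lt_vmid : N.vmin < N.vmid := N.gainAt_lt N.ρ_nonneg N.ρ_lt_D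

theorem vmid_le_vmax : N.vmid ≤ N.vmax := by
  rw [vmax_eq]
  exact N.antitoneOn_gainAt (Set.mem_Ici.2 le_rfl) N.ρ_nonneg N.ρ_nonneg

theorem gain_pos (u : ReceiverPlane) : 0 < N.gain u := by
  rw [gain_eq_gainAt]
  exact N.gainAt_pos _

theorem gain_le_vmax (u : ReceiverPlane) : N.gain u ≤ N.vmax := by
  rw [gain_eq_gainAt, vmax_eq]
  exact N.antitoneOn_gainAt (Set.mem_Ici.2 le_rfl) (norm_nonneg u) (norm_nonneg u)

theorem measurable_gain : Measurable N.gain := by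
  have : N.gain = fun u => N.gainAt ‖u‖ := funext N.gain_eq_gainAt
  rw [this]
  unfold gainAt
  fun_prop

theorem hasDerivAt_gainAt (r : ℝ) : HasDerivAt N.gainAt
    (-(N.gainConst * ((N.m + 3) * r * (r ^ 2 + N.l ^ 2) ^ (-((N.m + 3) / 2) - 1)))) r := by
  have h1 : HasDerivAt (fun r : ℝ => r ^ 2 + N.l ^ 2) (2 * r) r := by
    simpa using (hasDerivAt_pow 2 r).add_const (N.l ^ 2)
  refine ((h1.rpow_const (p := -((N.m + 3) / 2)) (Or.inl (N.sq_add_sq_pos r).ne')).const_mul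
    N.gainConst).congr_deriv ?_
  ring

/-- Substitution x = `gainAt r`, which is decreasing, so the endpoints swap and the sign of the
derivative is absorbed. The powers of r² + l² cancel, and so do those of `gainConst` up to the
constant in front. -/
theorem integral_comp_gainAt {r₀ r₁ : ℝ} (h0 : 0 ≤ r₀) (h1 : r₀ ≤ r₁) (f : ℝ → ℝ) :
    ∫ r in Set.Ioc r₀ r₁, r * f (N.gainAt r) = N.gainConst ^ (2 / (N.m + 3)) / (N.m + 3) *
      ∫ x in N.gainAt r₁..N.gainAt r₀, f x * x ^ (-(2 / (N.m + 3)) - 1) := by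
  have hm : 0 < N.m + 3 := by linarith [N.m_pos]
  have hK := N.gainConst_pos
  have hsub : Set.Icc r₀ r₁ ⊆ Set.Ici 0 := fun x hx => h0.trans hx.1
  have hanti := N.antitoneOn_gainAt.mono hsub
  have hcont : ContinuousOn N.gainAt (Set.Icc r₀ r₁) :=
    fun r _ => (N.hasDerivAt_gainAt r).continuousAt.continuousWithinAt
  have h := integral_image_eq_integral_deriv_smul_of_antitoneOn (measurableSet_Icc)
    (fun r _ => (N.hasDerivAt_gainAt r).hasDerivWithinAt) hanti
    (fun x => f x * x ^ (-(2 / (N.m + 3)) - 1))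
  rw [hcont.image_Icc_of_antitoneOn h1 hanti, integral_Icc_eq_integral_Ioc,
    integral_Icc_eq_integral_Ioc, ← intervalIntegral.integral_of_le
      (hanti (Set.left_mem_Icc.2 h1) (Set.right_mem_Icc.2 h1) h1)] at h
  rw [h, ← integral_const_mul]
  congr 1
  ext r
  have hs := N.sq_add_sq_pos r
  have e1 : N.gainAt r ^ (-(2 / (N.m + 3)) - 1) = N.gainConst ^ (-(2 / (N.m + 3)) - 1) *
      (r ^ 2 + N.l ^ 2) ^ (1 + (N.m + 3) / 2) := by
    rw [gainAt, Real.mul_rpow hK.le (Real.rpow_nonneg hs.le _), ← Real.rpow_mul hs.le]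
    congr 2
    field_simp
    ring
  have e2 : (r ^ 2 + N.l ^ 2) ^ (-((N.m + 3) / 2) - 1) * (r ^ 2 + N.l ^ 2) ^ (1 + (N.m + 3) / 2)
      = 1 := by
    rw [← Real.rpow_add hs]
    convert Real.rpow_zero _ using 2
    ring
  have e3 : N.gainConst ^ (2 / (N.m + 3)) * N.gainConst ^ (-(2 / (N.m + 3)) - 1) * N.gainConst
      = 1 := by
    rw [← Real.rpow_add hK, ← Real.rpow_add_one hK.ne']
    convert Real.rpow_zero _ using 2
    ring
  rw [e1, neg_neg, smul_eq_mul]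
  calc r * f (N.gainAt r) = (N.gainConst ^ (2 / (N.m + 3)) *
          N.gainConst ^ (-(2 / (N.m + 3)) - 1) * N.gainConst) * ((r ^ 2 + N.l ^ 2) ^
          (-((N.m + 3) / 2) - 1) * (r ^ 2 + N.l ^ 2) ^ (1 + (N.m + 3) / 2)) *
          (r * f (N.gainAt r)) := by rw [e2, e3]; ring
    _ = _ := by
      field_simp

theorem volume_real_annulus {I : Set ℝ} (hI : MeasurableSet I) {r₀ r₁ : ℝ}
    (h1 : r₀ ≤ r₁) (hIoc : Set.Ioi 0 ∩ I = Set.Ioc r₀ r₁) :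
    volume.real ((norm : ReceiverPlane → ℝ) ⁻¹' I) = Real.pi * (r₁ ^ 2 - r₀ ^ 2) := by
  have h := setIntegral_norm_receiverPlane hI (fun _ => 1)
  rw [hIoc, ← intervalIntegral.integral_of_le h1] at h
  simp only [mul_one, integral_id, setIntegral_const, smul_eq_mul] at h
  rw [h]
  ring

/-- The 2π of polar coordinates over the area π(r₁² - r₀²) gives the factor in front; it is `Ξ₁` for
the radii 0, D and `Ξ₂` for ρ, D. -/
theorem integral_cond_annulus {I : Set ℝ} (hI : MeasurableSet I) {r₀ r₁ : ℝ} (h0 : 0 ≤ r₀)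
    (h1 : r₀ ≤ r₁) (hIoc : Set.Ioi 0 ∩ I = Set.Ioc r₀ r₁) (f : ℝ → ℝ) :
    ∫ u, f (N.gain u) ∂ProbabilityTheory.cond volume ((norm : ReceiverPlane → ℝ) ⁻¹' I)
      = 2 / ((N.m + 3) * (r₁ ^ 2 - r₀ ^ 2)) * N.gainConst ^ (2 / (N.m + 3)) *
      ∫ x in N.gainAt r₁..N.gainAt r₀, f x * x ^ (-(2 / (N.m + 3)) - 1) := by
  have hv := volume_real_annulus hI h1 hIoc
  have h := setIntegral_norm_receiverPlane hI (fun r => f (N.gainAt r))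
  rw [hIoc, integral_comp_gainAt N h0 h1] at h
  simp_rw [← gain_eq_gainAt] at h
  rw [ProbabilityTheory.cond, integral_smul_measure, h, ENNReal.toReal_inv,
    ← measureReal_def, hv, smul_eq_mul, mul_inv]
  have := Real.pi_pos
  have : N.m + 3 ≠ 0 := by linarith [N.m_pos]
  rw [div_mul_eq_mul_div, div_mul_eq_mul_div, mul_div_assoc' ]
  field_simp

end VLCNetwork

/-! ### Integrals over the part of a rectangle below a line -/

theorem intervalIntegral_ite_le {g : ℝ → ℝ} {a b t : ℝ} (hat : a ≤ t) (htb : t ≤ b) :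
    ∫ y in a..b, (if y ≤ t then g y else 0) = ∫ y in a..t, g y := by
  rw [intervalIntegral.integral_of_le (hat.trans htb), intervalIntegral.integral_of_le hat]
  have : (fun y => if y ≤ t then g y else 0) = (Set.Iic t).indicator g := by
    ext y
    simp [Set.indicator_apply]
  rw [this, setIntegral_indicator measurableSet_Iic, Set.Ioc_inter_Iic, min_eq_right htb]

theorem intervalIntegral_ite_ge {g : ℝ → ℝ} {a b t : ℝ} (hat : a ≤ t) (htb : t ≤ b) :
    ∫ y in a..b, (if t ≤ y then g y else 0) = ∫ y in t..b, g y := by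
  rw [intervalIntegral.integral_of_le (hat.trans htb), intervalIntegral.integral_of_le htb,
    ← integral_Icc_eq_integral_Ioc, ← integral_Icc_eq_integral_Ioc]
  have : (fun y => if t ≤ y then g y else 0) = (Set.Ici t).indicator g := by
    ext y
    simp [Set.indicator_apply]
  rw [this, setIntegral_indicator measurableSet_Ici]
  congr 2
  ext y
  simp only [Set.mem_inter_iff, Set.mem_Icc, Set.mem_Ici]
  constructor
  · rintro ⟨⟨_, h⟩, h'⟩
    exact ⟨h', h⟩
  · rintro ⟨h', h⟩
    exact ⟨⟨hat.trans h', h⟩, h'⟩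

theorem intervalIntegral_three_pieces {f f₁ f₂ f₃ : ℝ → ℝ} {a p q b : ℝ} (hap : a ≤ p)
    (hpq : p ≤ q) (hqb : q ≤ b) (hf : IntegrableOn f (Set.Ioc a b))
    (h₁ : ∀ x ∈ Set.Ioc a p, f x = f₁ x) (h₂ : ∀ x ∈ Set.Ioc p q, f x = f₂ x)
    (h₃ : ∀ x ∈ Set.Ioc q b, f x = f₃ x) :
    ∫ x in a..b, f x = (∫ x in a..p, f₁ x) + (∫ x in p..q, f₂ x) + ∫ x in q..b, f₃ x := by
  have hI : ∀ c d, a ≤ c → c ≤ d → d ≤ b → IntervalIntegrable f volume c d := by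
    intro c d hac hcd hdb
    rw [intervalIntegrable_iff_integrableOn_Ioc_of_le hcd]
    exact hf.mono_set (Set.Ioc_subset_Ioc hac hdb)
  have hcongr : ∀ {c d : ℝ} {g : ℝ → ℝ}, c ≤ d → (∀ x ∈ Set.Ioc c d, f x = g x) →
      ∫ x in c..d, f x = ∫ x in c..d, g x := by
    intro c d g hcd h
    rw [intervalIntegral.integral_of_le hcd, intervalIntegral.integral_of_le hcd]
    exact setIntegral_congr_fun measurableSet_Ioc h
  rw [← hcongr hap h₁, ← hcongr hpq h₂, ← hcongr hqb h₃,
    intervalIntegral.integral_add_adjacent_intervals (hI a p le_rfl hap (hpq.trans hqb))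
      (hI p q hap hpq hqb),
    intervalIntegral.integral_add_adjacent_intervals (hI a q le_rfl (hap.trans hpq) hqb)
      (hI q b (hap.trans hpq) hqb le_rfl)]

theorem integral_rpow_neg_sub_one {r a b : ℝ} (hr : 0 < r) (ha : 0 < a) (hb : 0 < b) :
    ∫ x in a..b, x ^ (-r - 1) = r⁻¹ * (a ^ (-r) - b ^ (-r)) := by
  rw [integral_rpow (Or.inr ⟨by linarith, Set.notMem_uIcc_of_lt ha hb⟩), sub_add_cancel]
  field_simp
  ring

theorem continuousOn_rpow_mul {F : ℝ → ℝ} (hF : Continuous F) (r : ℝ) {a b : ℝ} (ha : 0 < a)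
    (hb : 0 < b) : ContinuousOn (fun x : ℝ => x ^ r * F x) (Set.uIcc a b) := by
  refine ContinuousOn.mul (fun x hx => ?_) hF.continuousOn
  have : x ≠ 0 := fun h => Set.notMem_uIcc_of_lt ha hb (h ▸ hx)
  exact (Real.continuousAt_rpow_const x r (Or.inl this)).continuousWithinAt

/-- `x` runs through `(v₀, v₂]` and `y` through the part below `χ x` of `(v₀, v₁]`; the
break points `p₁`, `p₂` are those of `x ↦ min (max (χ x) v₀) v₁`. -/
theorem integral_below_line {F : ℝ → ℝ} (hF : Continuous F) {r χ v₀ v₁ v₂ p₁ p₂ : ℝ} (hr : 0 < r)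
    (hχ : 0 < χ) (hv₀ : 0 < v₀) (h01 : v₀ ≤ v₁) (h0p : v₀ ≤ p₁) (hp : p₁ ≤ p₂) (hp2 : p₂ ≤ v₂)
    (h₁ : ∀ x ∈ Set.Ioc v₀ p₁, χ * x ≤ v₀) (h₂ : ∀ x ∈ Set.Ioc p₁ p₂, v₀ ≤ χ * x ∧ χ * x ≤ v₁)
    (h₃ : ∀ x ∈ Set.Ioc p₂ v₂, v₁ ≤ χ * x)
    (hint : IntegrableOn (fun x => x ^ (-r - 1) * F x *
      ∫ y in v₀..v₁, if y ≤ χ * x then y ^ (-r - 1) else 0) (Set.Ioc v₀ v₂)) :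
    ∫ x in v₀..v₂, x ^ (-r - 1) * F x * (∫ y in v₀..v₁, if y ≤ χ * x then y ^ (-r - 1) else 0)
      = r⁻¹ * (v₀ ^ (-r) * (∫ x in p₁..p₂, x ^ (-r - 1) * F x)
        - χ ^ (-r) * (∫ x in p₁..p₂, x ^ (-(2 * r) - 1) * F x)
        + (v₀ ^ (-r) - v₁ ^ (-r)) * ∫ x in p₂..v₂, x ^ (-r - 1) * F x) := by
  have hp1 : 0 < p₁ := hv₀.trans_le h0p
  have hp2' : 0 < p₂ := hp1.trans_le hp
  rw [intervalIntegral_three_pieces h0p hp hp2 hint (f₁ := fun _ => 0)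
    (f₂ := fun x => r⁻¹ * (v₀ ^ (-r) * (x ^ (-r - 1) * F x)
      - χ ^ (-r) * (x ^ (-(2 * r) - 1) * F x)))
    (f₃ := fun x => r⁻¹ * (v₀ ^ (-r) - v₁ ^ (-r)) * (x ^ (-r - 1) * F x))]
  · rw [intervalIntegral.integral_zero, intervalIntegral.integral_const_mul,
      intervalIntegral.integral_const_mul, intervalIntegral.integral_sub,
      intervalIntegral.integral_const_mul, intervalIntegral.integral_const_mul]
    · ring
    · exact ((continuousOn_rpow_mul hF _ hp1 hp2').intervalIntegrable).const_mul _
    · exact ((continuousOn_rpow_mul hF _ hp1 hp2').intervalIntegrable).const_mul _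
  · intro x hx
    have : ∫ y in v₀..v₁, (if y ≤ χ * x then y ^ (-r - 1) else 0) = ∫ y in v₀..v₁, (0 : ℝ) := by
      rw [intervalIntegral.integral_of_le h01, intervalIntegral.integral_of_le h01]
      refine setIntegral_congr_fun measurableSet_Ioc fun y hy => ?_
      exact if_neg (not_le.2 ((h₁ x hx).trans_lt hy.1))
    rw [this, intervalIntegral.integral_zero, mul_zero]
  · intro x hx
    have hx0 : 0 < x := hp1.trans hx.1
    obtain ⟨ha, hb⟩ := h₂ x hx
    rw [intervalIntegral_ite_le ha hb, integral_rpow_neg_sub_one hr hv₀ (by positivity),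
      Real.mul_rpow hχ.le hx0.le]
    -- The inner integral stops at y = χx, and its value there contributes a further x^(-r). This
    -- doubled exponent is the source of the terms `λ(q/2, …)`.
    have : x ^ (-(2 * r) - 1) = x ^ (-r - 1) * x ^ (-r) := by
      rw [← Real.rpow_add hx0]
      congr 1
      ring
    rw [this]
    ring
  · intro x hx
    have : ∫ y in v₀..v₁, (if y ≤ χ * x then y ^ (-r - 1) else 0)
        = ∫ y in v₀..v₁, y ^ (-r - 1) := by
      rw [intervalIntegral.integral_of_le h01, intervalIntegral.integral_of_le h01]
      refine setIntegral_congr_fun measurableSet_Ioc fun y hy => ?_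
      exact if_pos (hy.2.trans (h₃ x hx))
    rw [this, integral_rpow_neg_sub_one hr hv₀ (hv₀.trans_le h01)]
    ring

/-- The counterpart of `integral_below_line` in which `y` is the outer variable. -/
theorem integral_above_line {G : ℝ → ℝ} (hG : Continuous G) {r χ v₀ v₁ v₂ e₁ e₂ : ℝ} (hr : 0 < r)
    (hχ : 0 < χ) (hv₀ : 0 < v₀) (h02 : v₀ ≤ v₂) (h0e : v₀ ≤ e₁) (he : e₁ ≤ e₂) (he1 : e₂ ≤ v₁)
    (h₁ : ∀ y ∈ Set.Ioc v₀ e₁, y ≤ χ * v₀)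
    (h₂ : ∀ y ∈ Set.Ioc e₁ e₂, χ * v₀ ≤ y ∧ y ≤ χ * v₂)
    (h₃ : ∀ y ∈ Set.Ioc e₂ v₁, χ * v₂ ≤ y)
    (hint : IntegrableOn (fun y => y ^ (-r - 1) * G y *
      ∫ x in v₀..v₂, if y ≤ χ * x then x ^ (-r - 1) else 0) (Set.Ioc v₀ v₁)) :
    ∫ y in v₀..v₁, y ^ (-r - 1) * G y * (∫ x in v₀..v₂, if y ≤ χ * x then x ^ (-r - 1) else 0)
      = r⁻¹ * ((v₀ ^ (-r) - v₂ ^ (-r)) * (∫ y in v₀..e₁, y ^ (-r - 1) * G y)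
        + χ ^ r * (∫ y in e₁..e₂, y ^ (-(2 * r) - 1) * G y)
        - v₂ ^ (-r) * ∫ y in e₁..e₂, y ^ (-r - 1) * G y) := by
  have he1' : 0 < e₁ := hv₀.trans_le h0e
  have he2' : 0 < e₂ := he1'.trans_le he
  have hline : ∀ x y : ℝ, y ≤ χ * x ↔ y / χ ≤ x := fun x y => (div_le_iff₀' hχ).symm
  rw [intervalIntegral_three_pieces h0e he he1 hint
    (f₁ := fun y => r⁻¹ * (v₀ ^ (-r) - v₂ ^ (-r)) * (y ^ (-r - 1) * G y))
    (f₂ := fun y => r⁻¹ * (χ ^ r * (y ^ (-(2 * r) - 1) * G y)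
      - v₂ ^ (-r) * (y ^ (-r - 1) * G y))) (f₃ := fun _ => 0)]
  · rw [intervalIntegral.integral_zero, intervalIntegral.integral_const_mul,
      intervalIntegral.integral_const_mul, intervalIntegral.integral_sub,
      intervalIntegral.integral_const_mul, intervalIntegral.integral_const_mul]
    · ring
    · exact ((continuousOn_rpow_mul hG _ he1' he2').intervalIntegrable).const_mul _
    · exact ((continuousOn_rpow_mul hG _ he1' he2').intervalIntegrable).const_mul _
  · intro y hy
    have : ∫ x in v₀..v₂, (if y ≤ χ * x then x ^ (-r - 1) else 0)
        = ∫ x in v₀..v₂, x ^ (-r - 1) := by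
      rw [intervalIntegral.integral_of_le h02, intervalIntegral.integral_of_le h02]
      refine setIntegral_congr_fun measurableSet_Ioc fun x hx => ?_
      exact if_pos ((h₁ y hy).trans (by gcongr; exact hx.1.le))
    rw [this, integral_rpow_neg_sub_one hr hv₀ (hv₀.trans_le h02)]
    ring
  · intro y hy
    have hy0 : 0 < y := he1'.trans hy.1
    obtain ⟨ha, hb⟩ := h₂ y hy
    simp_rw [hline]
    rw [intervalIntegral_ite_ge ((le_div_iff₀' hχ).2 ha) ((div_le_iff₀' hχ).2 hb),
      integral_rpow_neg_sub_one hr (by positivity) (hv₀.trans_le h02),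
      Real.div_rpow hy0.le hχ.le, Real.rpow_neg hχ.le, div_inv_eq_mul]
    have : y ^ (-(2 * r) - 1) = y ^ (-r - 1) * y ^ (-r) := by
      rw [← Real.rpow_add hy0]
      congr 1
      ring
    rw [this]
    ring
  · intro y hy
    have : ∫ x in v₀..v₂, (if y ≤ χ * x then x ^ (-r - 1) else 0) = ∫ x in v₀..v₂, (0 : ℝ) := by
      -- The endpoint x = v₂ is dropped: the condition y ≤ χx can hold there when y = χv₂.
      rw [intervalIntegral.integral_of_le h02, intervalIntegral.integral_of_le h02,
        integral_Ioc_eq_integral_Ioo, integral_Ioc_eq_integral_Ioo]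
      refine setIntegral_congr_fun measurableSet_Ioo fun x hx => ?_
      refine if_neg (not_le.2 (lt_of_lt_of_le ?_ (h₃ y hy)))
      gcongr
      exact hx.2
    rw [this, intervalIntegral.integral_zero, mul_zero]

/-- Fubini is applied to the two terms separately: F is integrated in y first, G in x first, over
the same region y ≤ χx. The p's cut the x-axis and the e's the y-axis where the inner range changes
form. -/
theorem integral_truncated {F G : ℝ → ℝ} (hF : Continuous F) (hG : Continuous G)
    {r χ v₀ v₁ v₂ p₁ p₂ e₁ e₂ : ℝ} (hr : 0 < r)
    (hχ : 0 < χ) (hv₀ : 0 < v₀) (h0p : v₀ ≤ p₁) (hp : p₁ ≤ p₂) (hp2 : p₂ ≤ v₂)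
    (h₁ : ∀ x ∈ Set.Ioc v₀ p₁, χ * x ≤ v₀) (h₂ : ∀ x ∈ Set.Ioc p₁ p₂, v₀ ≤ χ * x ∧ χ * x ≤ v₁)
    (h₃ : ∀ x ∈ Set.Ioc p₂ v₂, v₁ ≤ χ * x)
    (h0e : v₀ ≤ e₁) (he : e₁ ≤ e₂) (he1 : e₂ ≤ v₁)
    (k₁ : ∀ y ∈ Set.Ioc v₀ e₁, y ≤ χ * v₀)
    (k₂ : ∀ y ∈ Set.Ioc e₁ e₂, χ * v₀ ≤ y ∧ y ≤ χ * v₂)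
    (k₃ : ∀ y ∈ Set.Ioc e₂ v₁, χ * v₂ ≤ y) :
    ∫ y in v₀..v₁, ∫ x in v₀..v₂,
        (if y ≤ χ * x then F x - G y else 0) * x ^ (-r - 1) * y ^ (-r - 1)
      = r⁻¹ * (v₀ ^ (-r) * (∫ x in p₁..p₂, x ^ (-r - 1) * F x)
        - χ ^ (-r) * (∫ x in p₁..p₂, x ^ (-(2 * r) - 1) * F x)
        + (v₀ ^ (-r) - v₁ ^ (-r)) * ∫ x in p₂..v₂, x ^ (-r - 1) * F x)
        - r⁻¹ * ((v₀ ^ (-r) - v₂ ^ (-r)) * (∫ y in v₀..e₁, y ^ (-r - 1) * G y)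
        + χ ^ r * (∫ y in e₁..e₂, y ^ (-(2 * r) - 1) * G y)
        - v₂ ^ (-r) * ∫ y in e₁..e₂, y ^ (-r - 1) * G y) := by
  have h01 : v₀ ≤ v₁ := h0e.trans (he.trans he1)
  have h02 : v₀ ≤ v₂ := h0p.trans (hp.trans hp2)
  have hI : ∀ {H : ℝ → ℝ} {v : ℝ}, Continuous H → v₀ ≤ v →
      IntegrableOn (fun x : ℝ => x ^ (-r - 1) * H x) (Set.Ioc v₀ v) := by
    intro H v hH hv
    rw [← intervalIntegrable_iff_integrableOn_Ioc_of_le hv]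
    exact (continuousOn_rpow_mul hH _ hv₀ (hv₀.trans_le hv)).intervalIntegrable
  have hw : ∀ {v : ℝ}, v₀ ≤ v → IntegrableOn (fun x : ℝ => x ^ (-r - 1)) (Set.Ioc v₀ v) := by
    intro v hv
    simpa using hI (continuous_const (y := (1 : ℝ))) hv
  set μ₁ := (volume : Measure ℝ).restrict (Set.Ioc v₀ v₁) with hμ₁
  set μ₂ := (volume : Measure ℝ).restrict (Set.Ioc v₀ v₂) with hμ₂
  have hT : MeasurableSet {z : ℝ × ℝ | z.2 ≤ χ * z.1} :=
    measurableSet_le (by fun_prop) (by fun_prop)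
  set PB : ℝ × ℝ → ℝ := {z : ℝ × ℝ | z.2 ≤ χ * z.1}.indicator
    fun z => z.1 ^ (-r - 1) * F z.1 * z.2 ^ (-r - 1) with hPB
  set PE : ℝ × ℝ → ℝ := {z : ℝ × ℝ | z.2 ≤ χ * z.1}.indicator
    fun z => z.1 ^ (-r - 1) * (z.2 ^ (-r - 1) * G z.2) with hPE
  -- Each part is a product of integrable functions of one variable, restricted to a measurable set.
  have hPBi : Integrable PB (μ₂.prod μ₁) := ((hI hF h02).mul_prod (hw h01)).indicator hT
  have hPEi : Integrable PE (μ₂.prod μ₁) := ((hw h02).mul_prod (hI hG h01)).indicator hT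
  have hB : ∀ x, ∫ y, PB (x, y) ∂μ₁ = x ^ (-r - 1) * F x *
      ∫ y in v₀..v₁, if y ≤ χ * x then y ^ (-r - 1) else 0 := by
    intro x
    rw [intervalIntegral.integral_of_le h01, ← integral_const_mul]
    refine integral_congr_ae (Filter.Eventually.of_forall fun y => ?_)
    by_cases h : y ≤ χ * x <;> simp [hPB, h]
  have hE : ∀ y, ∫ x, PE (x, y) ∂μ₂ = y ^ (-r - 1) * G y *
      ∫ x in v₀..v₂, if y ≤ χ * x then x ^ (-r - 1) else 0 := by
    intro y
    rw [intervalIntegral.integral_of_le h02, ← integral_const_mul]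
    refine integral_congr_ae (Filter.Eventually.of_forall fun x => ?_)
    by_cases h : y ≤ χ * x <;> simp [hPE, h, mul_comm]
  have hintB := hPBi.integral_prod_left
  have hintE := hPEi.integral_prod_right
  simp_rw [hB] at hintB
  simp_rw [hE] at hintE
  rw [← integral_below_line hF hr hχ hv₀ h01 h0p hp hp2 h₁ h₂ h₃ hintB,
    ← integral_above_line hG hr hχ hv₀ h02 h0e he he1 k₁ k₂ k₃ hintE,
    intervalIntegral.integral_of_le h01, intervalIntegral.integral_of_le h01,
    intervalIntegral.integral_of_le h02]
  simp_rw [← hB, ← hE]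
  rw [← integral_prod PB hPBi, ← integral_prod_symm PE hPEi, ← integral_sub hPBi hPEi,
    integral_prod_symm (fun z => PB z - PE z) (hPBi.sub hPEi)]
  refine integral_congr_ae (Filter.Eventually.of_forall fun y => ?_)
  dsimp only
  rw [intervalIntegral.integral_of_le h02]
  refine integral_congr_ae (Filter.Eventually.of_forall fun x => ?_)
  by_cases h : y ≤ χ * x
  · simp only [hPB, hPE, Set.indicator_apply, Set.mem_ofPred_eq, h, if_true]
    ring
  · simp [hPB, hPE, h]

/-! ### The average secrecy capacity as a double integral -/

namespace VLCNetwork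

variable (N : VLCNetwork)

theorem χ_pos : 0 < N.χ := by
  have := N.σB_pos; have := N.σE_pos; have := Real.pi_pos
  rw [χ]
  positivity

theorem dB_pos : 0 < N.dB := by
  have := N.σB_pos; have := Real.pi_pos
  rw [dB]
  positivity

theorem dE_pos : 0 < N.dE := by
  have := N.σE_pos
  rw [dE]
  positivity

theorem one_add_pos {d : ℝ} (hd : 0 < d) (x : ℝ) : 0 < 1 + d * N.ξ ^ 2 * N.P ^ 2 * x ^ 2 := by
  positivity

/-- Pulling 2πσ_B² out of the numerator and σ_E² out of the denominator cancels the prefactor. The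
constant in `logTerm` drops out of the difference. -/
theorem secrecyCapacityPlus_eq (x y : ℝ) :
    N.secrecyCapacityPlus x y = (N.logTerm N.dB x - N.logTerm N.dE y) / 2 := by
  have hB := N.one_add_pos N.dB_pos x
  have hE := N.one_add_pos N.dE_pos y
  have h1 : N.σE ^ 2 / (2 * Real.pi * N.σB ^ 2) *
      ((Real.exp 1 * N.ξ ^ 2 * N.P ^ 2 * (10 : ℝ) ^ (N.ηB / 5) * x ^ 2 + 2 * Real.pi * N.σB ^ 2) /
      ((10 : ℝ) ^ (N.ηE / 5) * y ^ 2 * N.ξ ^ 2 * N.P ^ 2 + N.σE ^ 2))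
      = (1 + N.dB * N.ξ ^ 2 * N.P ^ 2 * x ^ 2) / (1 + N.dE * N.ξ ^ 2 * N.P ^ 2 * y ^ 2) := by
    have h1 := N.σB_pos; have h2 := N.σE_pos; have := Real.pi_pos
    have h3 : Real.exp 1 * N.ξ ^ 2 * N.P ^ 2 * (10 : ℝ) ^ (N.ηB / 5) * x ^ 2
        + 2 * Real.pi * N.σB ^ 2
        = 2 * Real.pi * N.σB ^ 2 * (1 + N.dB * N.ξ ^ 2 * N.P ^ 2 * x ^ 2) := by
      rw [dB]
      field_simp
      ring
    have h4 : (10 : ℝ) ^ (N.ηE / 5) * y ^ 2 * N.ξ ^ 2 * N.P ^ 2 + N.σE ^ 2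
        = N.σE ^ 2 * (1 + N.dE * N.ξ ^ 2 * N.P ^ 2 * y ^ 2) := by
      rw [dE]
      field_simp
      ring
    rw [h3, h4]
    field_simp
  rw [secrecyCapacityPlus, h1, Real.log_div hB.ne' hE.ne', logTerm, logTerm]
  ring

theorem continuous_logTerm {d : ℝ} (hd : 0 < d) : Continuous (N.logTerm d) := by
  have : ∀ x, 1 + d * N.ξ ^ 2 * N.P ^ 2 * x ^ 2 ≠ 0 := fun x => (N.one_add_pos hd x).ne'
  unfold logTerm
  fun_prop (disch := assumption)

theorem measurable_secrecyCapacity :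
    Measurable fun z : ℝ × ℝ => N.secrecyCapacity z.1 z.2 := by
  unfold secrecyCapacity
  refine Measurable.ite (measurableSet_le (by fun_prop) (by fun_prop)) ?_ measurable_const
  unfold secrecyCapacityPlus
  fun_prop

theorem abs_log_one_add_sq_le {d x : ℝ} (hd : 0 < d) (hx : 0 < x) (hx' : x ≤ N.vmax) :
    |Real.log (1 + d * N.ξ ^ 2 * N.P ^ 2 * x ^ 2)| ≤ d * N.ξ ^ 2 * N.P ^ 2 * N.vmax ^ 2 :=
  (abs_log_one_add_le (by positivity)).trans (by gcongr)

theorem norm_secrecyCapacity_le {x y : ℝ} (hx : 0 < x) (hx' : x ≤ N.vmax) (hy : 0 < y)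
    (hy' : y ≤ N.vmax) :
    ‖N.secrecyCapacity x y‖ ≤ (N.dB + N.dE) * N.ξ ^ 2 * N.P ^ 2 * N.vmax ^ 2 := by
  have hB := abs_le.1 (N.abs_log_one_add_sq_le N.dB_pos hx hx')
  have hE := abs_le.1 (N.abs_log_one_add_sq_le N.dE_pos hy hy')
  have hB0 : 0 ≤ N.dB * N.ξ ^ 2 * N.P ^ 2 * N.vmax ^ 2 := by have := N.dB_pos; positivity
  have hE0 : 0 ≤ N.dE * N.ξ ^ 2 * N.P ^ 2 * N.vmax ^ 2 := by have := N.dE_pos; positivity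
  rw [secrecyCapacity, secrecyCapacityPlus_eq, logTerm, logTerm, Real.norm_eq_abs, abs_le]
  split_ifs <;> constructor <;> linarith [hB.1, hB.2, hE.1, hE.2]

theorem D_pos : 0 < N.D := N.ρ_nonneg.trans_lt N.ρ_lt_D

theorem receiverZone_eq : N.receiverZone = (norm : ReceiverPlane → ℝ) ⁻¹' Set.Iic N.D := by
  ext u
  simp [receiverZone]

theorem receiverZone_diff_eq : N.receiverZone \ N.protectedZone
    = (norm : ReceiverPlane → ℝ) ⁻¹' Set.Ioc N.ρ N.D := by
  ext u
  simp [receiverZone, protectedZone, and_comm]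

theorem Ioi_inter_Iic_D : Set.Ioi 0 ∩ Set.Iic N.D = Set.Ioc 0 N.D := rfl

theorem Ioi_inter_Ioc : Set.Ioi 0 ∩ Set.Ioc N.ρ N.D = Set.Ioc N.ρ N.D :=
  Set.inter_eq_right.2 fun _ hx => N.ρ_nonneg.trans_lt hx.1

/-- Uniformity prescribes only the pushforward, which is zero by convention for a map that is not
a.e. measurable. Positive finite area rules this out. -/
theorem aemeasurable_of_isUniform {Ω : Type*} [MeasurableSpace Ω] {μ : Measure Ω}
    {X : Ω → ReceiverPlane} {I : Set ℝ} (hI : MeasurableSet I) {r₀ r₁ : ℝ} (h0 : 0 ≤ r₀)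
    (h1 : r₀ < r₁) (hIoc : Set.Ioi 0 ∩ I = Set.Ioc r₀ r₁)
    (hX : pdf.IsUniform X ((norm : ReceiverPlane → ℝ) ⁻¹' I) μ volume) : AEMeasurable X μ := by
  have hv := volume_real_annulus hI h1.le hIoc
  have hpos : 0 < Real.pi * (r₁ ^ 2 - r₀ ^ 2) :=
    mul_pos Real.pi_pos (by nlinarith)
  rw [← hv, measureReal_def, ENNReal.toReal_pos_iff] at hpos
  exact hX.aemeasurable hpos.1.ne' hpos.2.ne

theorem integral_Bob {f : ℝ → ℝ} :
    ∫ u, f (N.gain u) ∂ProbabilityTheory.cond volume N.receiverZone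
      = ∫ x in N.vmin..N.vmax, f x * N.pdfB x := by
  rw [receiverZone_eq, integral_cond_annulus N measurableSet_Iic le_rfl N.D_pos.le
    N.Ioi_inter_Iic_D, ← vmin_eq, ← vmax_eq, ← intervalIntegral.integral_const_mul]
  have hle : N.vmin ≤ N.vmax := N.vmin_lt_vmid.le.trans N.vmid_le_vmax
  refine intervalIntegral.integral_congr fun x hx => ?_
  rw [Set.uIcc_of_le hle, Set.mem_Icc] at hx
  rw [pdfB, if_pos hx, Ξ₁]
  ring

theorem integral_Eve {f : ℝ → ℝ} :
    ∫ u, f (N.gain u) ∂ProbabilityTheory.cond volume (N.receiverZone \ N.protectedZone)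
      = ∫ y in N.vmin..N.vmid, f y * N.pdfE y := by
  rw [receiverZone_diff_eq, integral_cond_annulus N measurableSet_Ioc N.ρ_nonneg N.ρ_lt_D.le
    N.Ioi_inter_Ioc, ← vmin_eq, ← vmid_eq, ← intervalIntegral.integral_const_mul]
  refine intervalIntegral.integral_congr fun y hy => ?_
  rw [Set.uIcc_of_le N.vmin_lt_vmid.le, Set.mem_Icc] at hy
  rw [pdfE, if_pos hy, Ξ₂]
  ring

section Average

variable {Ω : Type*} [MeasurableSpace Ω] {μ : Measure Ω} [IsProbabilityMeasure μ]
  {U W : Ω → ReceiverPlane}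

theorem integrable_secrecyCapacity (hU : AEMeasurable U μ) (hW : AEMeasurable W μ) :
    Integrable (fun ω => N.secrecyCapacity (N.gain (U ω)) (N.gain (W ω))) μ := by
  refine Integrable.of_bound ?_ ((N.dB + N.dE) * N.ξ ^ 2 * N.P ^ 2 * N.vmax ^ 2)
    (Filter.Eventually.of_forall fun ω => N.norm_secrecyCapacity_le (N.gain_pos _)
      (N.gain_le_vmax _) (N.gain_pos _) (N.gain_le_vmax _))
  exact (N.measurable_secrecyCapacity.comp_aemeasurable ((N.measurable_gain.comp_aemeasurable
    hU).prodMk (N.measurable_gain.comp_aemeasurable hW))).aestronglyMeasurable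

/-- Independence makes the joint law a product, so Fubini applies with Eve outside; each uniform law
is then replaced by the density of its gain. -/
theorem averageSecrecyCapacity_eq (hUm : AEMeasurable U μ) (hWm : AEMeasurable W μ)
    (hU : pdf.IsUniform U N.receiverZone μ volume)
    (hW : pdf.IsUniform W (N.receiverZone \ N.protectedZone) μ volume)
    (hUW : ProbabilityTheory.IndepFun U W μ) :
    N.averageSecrecyCapacity μ U W = ∫ y in N.vmin..N.vmid, ∫ x in N.vmin..N.vmax,
      N.secrecyCapacity x y * N.pdfB x * N.pdfE y := by
  have hlaw := (ProbabilityTheory.indepFun_iff_map_prod_eq_prod_map_map hUm hWm).1 hUW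
  have hmeas : Measurable fun z : ReceiverPlane × ReceiverPlane =>
      N.secrecyCapacity (N.gain z.1) (N.gain z.2) :=
    N.measurable_secrecyCapacity.comp ((N.measurable_gain.comp measurable_fst).prodMk
      (N.measurable_gain.comp measurable_snd))
  have hint := (integrable_map_measure hmeas.aestronglyMeasurable (hUm.prodMk hWm)).2
    (N.integrable_secrecyCapacity hUm hWm)
  rw [hlaw] at hint
  have h1 : N.averageSecrecyCapacity μ U W = ∫ z : ReceiverPlane × ReceiverPlane,
      N.secrecyCapacity (N.gain z.1) (N.gain z.2) ∂(μ.map fun ω => (U ω, W ω)) :=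
    (integral_map (hUm.prodMk hWm) hmeas.aestronglyMeasurable).symm
  have : IsProbabilityMeasure (μ.map U) := Measure.isProbabilityMeasure_map hUm
  have : IsProbabilityMeasure (μ.map W) := Measure.isProbabilityMeasure_map hWm
  rw [h1, hlaw, integral_prod_symm _ hint, show μ.map U = _ from hU, show μ.map W = _ from hW]
  dsimp only
  rw [N.integral_Eve (f := fun y => ∫ u, N.secrecyCapacity (N.gain u) y
    ∂ProbabilityTheory.cond volume N.receiverZone)]
  refine intervalIntegral.integral_congr fun y _ => ?_
  rw [N.integral_Bob (f := fun x => N.secrecyCapacity x y), intervalIntegral.integral_mul_const]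

end Average

/-! ### The closed form in terms of break points -/

theorem integral_secrecyCapacity_eq : ∫ y in N.vmin..N.vmid, ∫ x in N.vmin..N.vmax,
      N.secrecyCapacity x y * N.pdfB x * N.pdfE y
    = N.Ξ₁ * N.Ξ₂ / 2 * ∫ y in N.vmin..N.vmid, ∫ x in N.vmin..N.vmax,
      (if y ≤ N.χ * x then N.logTerm N.dB x - N.logTerm N.dE y else 0)
        * x ^ (-(2 / (N.m + 3)) - 1) * y ^ (-(2 / (N.m + 3)) - 1) := by
  rw [← intervalIntegral.integral_const_mul]
  refine intervalIntegral.integral_congr fun y hy => ?_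
  rw [← intervalIntegral.integral_const_mul]
  refine intervalIntegral.integral_congr fun x hx => ?_
  rw [Set.uIcc_of_le N.vmin_lt_vmid.le, Set.mem_Icc] at hy
  rw [Set.uIcc_of_le (N.vmin_lt_vmid.le.trans N.vmid_le_vmax), Set.mem_Icc] at hx
  rw [pdfB, pdfE, if_pos hx, if_pos hy, secrecyCapacity, secrecyCapacityPlus_eq]
  split_ifs <;> ring

/-- The integral represented by `λ (a, b, c, d)`. -/
noncomputable def lamIntegral (a b c d : ℝ) : ℝ := ∫ x in b..c, x ^ (-(1 / a) - 1) * N.logTerm d x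

theorem lamIntegral_self (a b d : ℝ) : N.lamIntegral a b b d = 0 :=
  intervalIntegral.integral_same

theorem lamIntegral_add (a : ℝ) {b c e d : ℝ} (hd : 0 < d) (hb : 0 < b) (hc : 0 < c)
    (he : 0 < e) : N.lamIntegral a b c d + N.lamIntegral a c e d = N.lamIntegral a b e d :=
  intervalIntegral.integral_add_adjacent_intervals
    (continuousOn_rpow_mul (N.continuous_logTerm hd) _ hb hc).intervalIntegrable
    (continuousOn_rpow_mul (N.continuous_logTerm hd) _ hc he).intervalIntegrable

theorem lam_half {b c d : ℝ} (hb : 0 < b) (hc : 0 < c) (hd : 0 < d) :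
    N.lam ((N.m + 3) / 2) b c d = (N.lamIntegral ((N.m + 3) / 2) b c d : ℂ) :=
  N.lam_eq_integral (by linarith [N.m_pos]) hb hc hd

/-- The parameter (m+3)/4 is the smaller of the two, and m > 0 still gives the 1 < 2a needed for the
Meijer integral. -/
theorem lam_quarter {b c d : ℝ} (hb : 0 < b) (hc : 0 < c) (hd : 0 < d) :
    N.lam ((N.m + 3) / 4) b c d = (N.lamIntegral ((N.m + 3) / 4) b c d : ℂ) :=
  N.lam_eq_integral (by linarith [N.m_pos]) hb hc hd

/-- All cases of the closed form at once, in terms of the break points of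
`x ↦ min (max (χ x) vmin) vmid` and `y ↦ min (max (y / χ) vmin) vmax`. -/
theorem integral_secrecyCapacity_of_breakpoints {p₁ p₂ e₁ e₂ : ℝ}
    (h0p : N.vmin ≤ p₁) (hp : p₁ ≤ p₂) (hp2 : p₂ ≤ N.vmax)
    (h₁ : ∀ x ∈ Set.Ioc N.vmin p₁, N.χ * x ≤ N.vmin)
    (h₂ : ∀ x ∈ Set.Ioc p₁ p₂, N.vmin ≤ N.χ * x ∧ N.χ * x ≤ N.vmid)
    (h₃ : ∀ x ∈ Set.Ioc p₂ N.vmax, N.vmid ≤ N.χ * x)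
    (h0e : N.vmin ≤ e₁) (he : e₁ ≤ e₂) (he1 : e₂ ≤ N.vmid)
    (k₁ : ∀ y ∈ Set.Ioc N.vmin e₁, y ≤ N.χ * N.vmin)
    (k₂ : ∀ y ∈ Set.Ioc e₁ e₂, N.χ * N.vmin ≤ y ∧ y ≤ N.χ * N.vmax)
    (k₃ : ∀ y ∈ Set.Ioc e₂ N.vmid, N.χ * N.vmax ≤ y) :
    ∫ y in N.vmin..N.vmid, ∫ x in N.vmin..N.vmax, N.secrecyCapacity x y * N.pdfB x * N.pdfE y
      = N.prefactor *
        (N.npow N.vmin * N.lamIntegral ((N.m + 3) / 2) p₁ p₂ N.dB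
          - N.npow N.χ * N.lamIntegral ((N.m + 3) / 4) p₁ p₂ N.dB
          + (N.npow N.vmin - N.npow N.vmid) * N.lamIntegral ((N.m + 3) / 2) p₂ N.vmax N.dB
          - (N.npow N.vmin - N.npow N.vmax) * N.lamIntegral ((N.m + 3) / 2) N.vmin e₁ N.dE
          - N.χ ^ (2 / (N.m + 3)) * N.lamIntegral ((N.m + 3) / 4) e₁ e₂ N.dE
          + N.npow N.vmax * N.lamIntegral ((N.m + 3) / 2) e₁ e₂ N.dE) := by
  have hm : 0 < N.m + 3 := by linarith [N.m_pos]
  -- With r = 2/(m+3), the parameters (m+3)/2 and (m+3)/4 give the exponents -r-1 and -2r-1, while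
  -- r⁻¹ times `Ξ₁ Ξ₂ / 2` is `prefactor`.
  have e2 : 1 / ((N.m + 3) / 2) = 2 / (N.m + 3) := by rw [one_div_div]
  have e4 : 1 / ((N.m + 3) / 4) = 2 * (2 / (N.m + 3)) := by rw [one_div_div]; ring
  have er : (2 / (N.m + 3))⁻¹ = (N.m + 3) / 2 := inv_div _ _
  rw [integral_secrecyCapacity_eq, integral_truncated (N.continuous_logTerm N.dB_pos)
    (N.continuous_logTerm N.dE_pos) (by positivity) N.χ_pos N.vmin_pos h0p hp hp2 h₁ h₂ h₃
    h0e he he1 k₁ k₂ k₃]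
  simp only [lamIntegral, npow, prefactor, e2, e4, er]
  ring

end VLCNetwork

/-! ### The five positions of the line relative to the rectangle -/

theorem theorem2 (N : VLCNetwork) {Ω : Type*} [MeasurableSpace Ω]
    (μ : MeasureTheory.Measure Ω) [MeasureTheory.IsProbabilityMeasure μ]
    (U W : Ω → ReceiverPlane)
    (hU : MeasureTheory.pdf.IsUniform U N.receiverZone μ MeasureTheory.volume)
    (hW : MeasureTheory.pdf.IsUniform W (N.receiverZone \ N.protectedZone) μ
      MeasureTheory.volume)
    (hUW : ProbabilityTheory.IndepFun U W μ) :
    MeasureTheory.Integrable (fun ω => N.secrecyCapacity (N.gain (U ω)) (N.gain (W ω))) μ ∧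
    N.averageSecrecyCapacity μ U W =
      ∫ y in N.vmin..N.vmid, ∫ x in N.vmin..N.vmax,
        N.secrecyCapacity x y * N.pdfB x * N.pdfE y ∧
    (N.χ ≤ N.vmin / N.vmax → N.averageSecrecyCapacity μ U W = 0) ∧
    (N.vmin / N.vmax < N.χ → N.χ ≤ N.vmid / N.vmax →
      (N.averageSecrecyCapacity μ U W : ℂ) = N.C₁) ∧
    (N.vmid / N.vmax < N.χ → N.χ ≤ 1 →
      (N.averageSecrecyCapacity μ U W : ℂ) = N.C₂) ∧
    (1 < N.χ → N.χ ≤ N.vmid / N.vmin →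
      (N.averageSecrecyCapacity μ U W : ℂ) = N.C₃) ∧
    (N.vmid / N.vmin < N.χ →
      (N.averageSecrecyCapacity μ U W : ℂ) = N.C₄) := by
  have hUm : AEMeasurable U μ := by
    rw [N.receiverZone_eq] at hU
    exact VLCNetwork.aemeasurable_of_isUniform measurableSet_Iic le_rfl N.D_pos
      N.Ioi_inter_Iic_D hU
  have hWm : AEMeasurable W μ := by
    rw [N.receiverZone_diff_eq] at hW
    exact VLCNetwork.aemeasurable_of_isUniform measurableSet_Ioc N.ρ_nonneg N.ρ_lt_D
      N.Ioi_inter_Ioc hW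
  have havg := N.averageSecrecyCapacity_eq hUm hWm hU hW hUW
  refine ⟨N.integrable_secrecyCapacity hUm hWm, havg, ?_⟩
  rw [havg]
  have hχ := N.χ_pos
  have hmin := N.vmin_pos
  have hmid := hmin.trans N.vmin_lt_vmid
  have hmax := hmid.trans_le N.vmid_le_vmax
  have h01 := N.vmin_lt_vmid.le
  have h12 := N.vmid_le_vmax
  have h02 := h01.trans h12
  have hB := N.dB_pos
  have hE := N.dE_pos
  have hχm : ∀ {x y : ℝ}, x ≤ y → N.χ * x ≤ N.χ * y := fun h => mul_le_mul_of_nonneg_left h hχ.le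
  have hdiv : ∀ v : ℝ, N.χ * (v / N.χ) = v := fun v => mul_div_cancel₀ v hχ.ne'
  refine ⟨fun h => ?_, fun h h' => ?_, fun h h' => ?_, fun h h' => ?_, fun h => ?_⟩
  -- The line stays at or below the bottom edge y = vmin: every piece is empty or contributes zero.
  · rw [le_div_iff₀ hmax] at h
    rw [N.integral_secrecyCapacity_of_breakpoints (p₁ := N.vmax) (p₂ := N.vmax) (e₁ := N.vmin)
      (e₂ := N.vmin) h02 le_rfl le_rfl (fun x hx => (hχm hx.2).trans h) (by simp) (by simp)
      le_rfl le_rfl h01 (by simp) (by simp) (fun y hy => h.trans hy.1.le)]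
    simp only [VLCNetwork.lamIntegral_self]
    ring
  -- The line crosses the bottom edge at x = vmin/χ and the right edge at y = χ vmax.
  · rw [div_lt_iff₀ hmax] at h
    rw [le_div_iff₀ hmax] at h'
    have hχ1 : N.χ ≤ 1 := by
      by_contra hc
      nlinarith
    have hs : N.vmin ≤ N.vmin / N.χ := by
      rw [le_div_iff₀ hχ]; nlinarith
    rw [N.integral_secrecyCapacity_of_breakpoints (p₁ := N.vmin / N.χ) (p₂ := N.vmax)
      (e₁ := N.vmin) (e₂ := N.χ * N.vmax) hs ((div_le_iff₀' hχ).2 h.le) le_rfl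
      (fun x hx => (hχm hx.2).trans (hdiv _).le)
      (fun x hx => ⟨(hdiv _).ge.trans (hχm hx.1.le), (hχm hx.2).trans h'⟩) (by simp)
      le_rfl h.le h' (by simp) (fun y hy => ⟨by nlinarith [hy.1], hy.2⟩) (fun y hy => hy.1.le)]
    have hq1 : 0 < N.vmin / N.χ := by positivity
    have hq2 : 0 < N.χ * N.vmax := by positivity
    rw [VLCNetwork.C₁, N.lam_half hq1 hmax hB, N.lam_quarter hq1 hmax hB,
      N.lam_half hmin hq2 hE, N.lam_quarter hmin hq2 hE]
    simp only [VLCNetwork.lamIntegral_self]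
    push_cast
    ring
  -- The line crosses the bottom edge at x = vmin/χ and the top edge at x = vmid/χ.
  · rw [div_lt_iff₀ hmax] at h
    have hs : N.vmin ≤ N.vmin / N.χ := by
      rw [le_div_iff₀ hχ]; nlinarith
    have hq1 : 0 < N.vmin / N.χ := by positivity
    have hq2 : 0 < N.vmid / N.χ := by positivity
    rw [N.integral_secrecyCapacity_of_breakpoints (p₁ := N.vmin / N.χ) (p₂ := N.vmid / N.χ)
      (e₁ := N.vmin) (e₂ := N.vmid) hs (by gcongr) ((div_le_iff₀' hχ).2 h.le)
      (fun x hx => (hχm hx.2).trans (hdiv _).le)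
      (fun x hx => ⟨(hdiv _).ge.trans (hχm hx.1.le), (hχm hx.2).trans (hdiv _).le⟩)
      (fun x hx => (hdiv _).ge.trans (hχm hx.1.le))
      le_rfl h01 le_rfl (by simp)
      (fun y hy => ⟨by nlinarith [hy.1], hy.2.trans h.le⟩) (by simp)]
    rw [VLCNetwork.C₂, N.lam_half hq1 hq2 hB, N.lam_quarter hq1 hq2 hB, N.lam_half hq2 hmax hB,
      N.lam_half hmin hmid hE, N.lam_quarter hmin hmid hE]
    simp only [VLCNetwork.lamIntegral_self]
    push_cast
    ring
  -- The line crosses the left edge at y = χ vmin and the top edge at x = vmid/χ.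
  · rw [le_div_iff₀ hmin] at h'
    have hs : N.vmin ≤ N.χ * N.vmin := by nlinarith
    have ht : N.vmid ≤ N.χ * N.vmax := by nlinarith
    have hq1 : 0 < N.χ * N.vmin := by positivity
    have hq2 : 0 < N.vmid / N.χ := by positivity
    rw [N.integral_secrecyCapacity_of_breakpoints (p₁ := N.vmin) (p₂ := N.vmid / N.χ)
      (e₁ := N.χ * N.vmin) (e₂ := N.vmid) le_rfl ((le_div_iff₀' hχ).2 h')
      ((div_le_iff₀' hχ).2 ht) (by simp)
      (fun x hx => ⟨hs.trans (hχm hx.1.le), (hχm hx.2).trans (hdiv _).le⟩)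
      (fun x hx => (hdiv _).ge.trans (hχm hx.1.le))
      hs h' le_rfl (fun y hy => hy.2) (fun y hy => ⟨hy.1.le, hy.2.trans ht⟩) (by simp)]
    -- `C₃` contains an Eve term over all of [vmin, vmid]; once it is split at χ vmin, the
    -- coefficients `npow (vmid / χ)` of the Eve terms cancel.
    rw [VLCNetwork.C₃, N.lam_half hmin hq2 hB, N.lam_quarter hmin hq2 hB,
      N.lam_half hmin hq1 hE, N.lam_quarter hq1 hmid hE, N.lam_half hq1 hmid hE,
      N.lam_half hq2 hmax hB, N.lam_half hmin hmid hE,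
      ← N.lamIntegral_add _ hE hmin hq1 hmid]
    push_cast
    ring
  -- The line passes above the whole rectangle, so the truncation is void.
  · rw [div_lt_iff₀ hmin] at h
    rw [N.integral_secrecyCapacity_of_breakpoints (p₁ := N.vmin) (p₂ := N.vmin)
      (e₁ := N.vmid) (e₂ := N.vmid) le_rfl le_rfl h02 (by simp) (by simp)
      (fun x hx => h.le.trans (hχm hx.1.le))
      h01 le_rfl le_rfl (fun y hy => hy.2.trans h.le) (by simp) (by simp)]
    rw [VLCNetwork.C₄, N.lam_half hmin hmax hB, N.lam_half hmin hmid hE]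
    simp only [VLCNetwork.lamIntegral_self]
    push_cast
    ring
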